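/- **Setting.** Let $A\in\mathbb{R}^{m\times n}$, $A\neq 0$, $b\in\mathbb{R}^m$, let $f:\mathbb{R}^n\to\mathbb{R}$ be $\mu_f$-strongly convex and let $g:\mathbb{R}^m\to\mathbb{R}$ be $\mu_g$-strongly convex and differentiable with $L_g$-Lipschitz gradient ($\mu_f,\mu_g>0$). Let $\hat y$ minimise $g^*(b-y)$ over $y\in\mathcal{R}(A)$, let $\hat x$ minimise $f$ subject to $Ax=\hat y$, and put $h(z)=g(z)-b^\top z$. Here $g^*,f^*$ are Fenchel conjugates, and $D_f^{x^*}(x,y)=f(y)-f(x)-\langle x^*,y-x\rangle$ for $x^*\in\partial f(x)$. Assume: * $\partial f$ grows at most linearly: $\|x^*\|_2\le\rho_1\|x\|_2+\rho_2$ for all $x$ and $x^*\in\partial f(x)$, with some $\rho_1,\rho_2\ge 0$; * $\partial f$ is calm at $\hat x$: $\partial f(x)\subset\partial f(\hat x)+L\|x-\hat x\|_2B_2$ whenever $\|x-\hat x\|_2\le c$, with some $c,L>0$ ($B_2$ is the closed unit ball); * $\{\partial f(\hat x),\mathcal{R}(A^\top)\}$ is linearly regular: $\partial f(\hat x)\cap\mathcal{R}(A^\top)\ne\emptyset$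 and, with some $\zeta>0$, $\mathrm{dist}(x^*,\partial f(\hat x)\cap\mathcal{R}(A^\top))\le\zeta\big(\mathrm{dist}(x^*,\partial f(\hat x))+\mathrm{dist}(x^*,\mathcal{R}(A^\top))\big)$ for all $x^*\in\mathbb{R}^n$. Let $\{\mathcal I_1,\dots,\mathcal I_s\}$ and $\{\mathcal J_1,\dots,\mathcal J_t\}$ be partitions of $[m]$ and $[n]$, and let $$\beta^{\mathcal I}_{\max}=\max_{i}\frac{\sigma_{\max}^2(A_{\mathcal I_i,:})}{\|A_{\mathcal I_i,:}\|_F^2},\qquad \beta^{\mathcal J}_{\max}=\max_{j}\frac{\sigma_{\max}^2(A_{:,\mathcal J_j})}{\|A_{:,\mathcal J_j}\|_F^2},$$ the maxima being over the nonzero blocks. The rRABEBK iteration with relaxation parameters $\alpha^{(x)},\alpha^{(z)}$ starts from $x_0^*=0$, $z_0^*=b$, and always $x_k=\nabla f^*(x_k^*)$, $z_k=\nabla g^*(z_k^*)$. In step $k$ it draws $j_k\in[t]$ and $i_k\in[s]$, all draws being independent, with probabilities $\|A_{:,\mathcal J_{j_k}}\|_F^2/\|A\|_F^2$ and $\|A_{\mathcal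 I_{i_k},:}\|_F^2/\|A\|_F^2$, and sets $$z_{k+1}^*=z_k^*-\tfrac{\alpha^{(z)}}{\|A_{:,\mathcal J_{j_k}}\|_F^2}A_{:,\mathcal J_{j_k}}A_{:,\mathcal J_{j_k}}^\top z_k,\qquad x_{k+1}^*=x_k^*-\tfrac{\alpha^{(x)}}{\|A_{\mathcal I_{i_k},:}\|_F^2}A_{\mathcal I_{i_k},:}^\top\big(A_{\mathcal I_{i_k},:}x_k-b_{\mathcal I_{i_k}}+z^*_{k+1,\mathcal I_{i_k}}\big).$$ **Theorem.** The points $\hat y$ and $\hat x$ are the unique solutions of their problems, and the problem $\min h(z)$ s.t. $A^\top z=0$ has a unique solution $\hat z$. There are $\gamma=\gamma(\hat x)>0$ and $\theta=\theta(\hat z)>0$ with the global error bounds $$D_f^{x^*}(x,\hat x)\le\tfrac1\gamma\|Ax-\hat y\|_2^2\ \ (x^*\in\partial f(x)\cap\mathcal R(A^\top)),\qquad D_h^{z^*}(z,\hat z)\le\tfrac1\theta\|A^\top z\|_2^2\ \ (z^*\in\partial h(z)\cap\mathcal R(A)).$$ (1) Let $0<\alpha^{(x)}\le\mu_f/\beta^{\mathcal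 I}_{\max}$, $0<\alpha^{(z)}<2\mu_g/\beta^{\mathcal J}_{\max}$ and $\varepsilon>0$, and let $$c_1=\frac{\alpha^{(x)}(2\mu_f-\beta^{\mathcal I}_{\max}\alpha^{(x)})-\frac1\varepsilon\alpha^{(x)}(\mu_f-\beta^{\mathcal I}_{\max}\alpha^{(x)})}{2\mu_f\|A\|_F^2},\qquad c_2=\frac{(\alpha^{(x)})^2\beta^{\mathcal I}_{\max}+\varepsilon\alpha^{(x)}(\mu_f-\beta^{\mathcal I}_{\max}\alpha^{(x)})}{2\mu_f\|A\|_F^2}.$$ If $c_1\ge 0$ (which is the case for every $\varepsilon\ge\frac12$, and for every $\varepsilon>0$ if $\alpha^{(x)}=\mu_f/\beta^{\mathcal I}_{\max}$), then, for all constants $\gamma,\theta>0$ for which the error bounds hold and all $k\ge 0$, $$\mathbb E\big[D_f^{x_{k+1}^*}(x_{k+1},\hat x)\big]\le(1-c_1\gamma)\,\mathbb E\big[D_f^{x_k^*}(x_k,\hat x)\big]+c_2\cdot 2L_g\Big(1-\frac{\alpha^{(z)}(2\mu_g-\beta^{\mathcal J}_{\max}\alpha^{(z)})\theta}{2\mu_g\|A\|_F^2}\Big)^{k+1}D_h^{0}(z_0,\hat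 z).$$ (2) For all such $\alpha^{(x)},\alpha^{(z)}$, in particular for $\alpha^{(x)}=\mu_f/\beta^{\mathcal I}_{\max}$, $\alpha^{(z)}=\mu_g/\beta^{\mathcal J}_{\max}$, the iterates converge in expectation to $\hat x$: all expectations below are finite, and $\mathbb E[D_f^{x_k^*}(x_k,\hat x)]\to0$, $\mathbb E\|x_k-\hat x\|_2^2\to0$ and $\mathbb E[x_k]\to\hat x$. (3) For every $\varepsilon>0$ and $\gamma>0$, the contraction factor $1-c_1\gamma$ is smallest over $0<\alpha^{(x)}\le\mu_f/\beta^{\mathcal I}_{\max}$ exactly at $\alpha^{(x)}=\mu_f/\beta^{\mathcal I}_{\max}$, where it equals $1-\frac{\mu_f\gamma}{2\beta^{\mathcal I}_{\max}\|A\|_F^2}$. For single-row blocks (the REBK method) $\beta^{\mathcal I}_{\max}=1$ and this factor is $1-\frac{\mu_f\gamma}{2\|A\|_F^2}$. The factor of rRABEBK never exceeds that of REBK, and it is strictly smaller if and only if no row block $A_{\mathcal I_i,:}$ has rank one. -/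

import Mathlib

open MeasureTheory ProbabilityTheory Filter Topology
open scoped NNReal

/-- Euclidean space `ℝⁿ`. -/
abbrev E (n : ℕ) : Type := EuclideanSpace ℝ (Fin n)

namespace BregmanKaczmarz

noncomputable section

/-! ### Convex analysis -/

/-- The subdifferential `∂f(x)`. -/
def subdiff {n : ℕ} (f : E n → ℝ) (x : E n) : Set (E n) :=
  {p | ∀ y, f x + inner ℝ p (y - x) ≤ f y}

/-- The Fenchel conjugate `f*(p) = sup_y (⟨p, y⟩ - f y)`; for a strongly convex finite-valued `f`
the supremum is finite for every `p`. -/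
def conj {n : ℕ} (f : E n → ℝ) (p : E n) : ℝ :=
  ⨆ y, (inner ℝ p y - f y)

/-- The Bregman distance `D_f^p(x, y) = f(y) - f(x) - ⟨p, y - x⟩`, for `p ∈ ∂f(x)`. -/
def bregman {n : ℕ} (f : E n → ℝ) (p x y : E n) : ℝ :=
  f y - f x - inner ℝ p (y - x)

/-- The range `R(A)` as a set of vectors. -/
def ran {m n : ℕ} (A : Matrix (Fin m) (Fin n) ℝ) : Set (E m) :=
  Set.range (fun x : E n => A.toEuclideanLin x)

/-- `x` solves `min f` subject to `A x = y`. -/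
def IsConstrainedMin {m n : ℕ} (f : E n → ℝ) (A : Matrix (Fin m) (Fin n) ℝ) (y : E m)
    (x : E n) : Prop :=
  A.toEuclideanLin x = y ∧ ∀ x', A.toEuclideanLin x' = y → f x ≤ f x'

/-- `y` minimises the data misfit `g*(b - y)` over `R(A)`. -/
def IsMisfitMin {m n : ℕ} (g : E m → ℝ) (A : Matrix (Fin m) (Fin n) ℝ) (b y : E m) : Prop :=
  y ∈ ran A ∧ ∀ y' ∈ ran A, conj g (b - y) ≤ conj g (b - y')

/-- The dual objective `h(z) = g(z) - bᵀ z`. -/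
def dualObj {m : ℕ} (g : E m → ℝ) (b z : E m) : ℝ :=
  g z - inner ℝ b z

/-- `∂f` grows at most linearly. -/
def GrowsAtMostLinearly {n : ℕ} (f : E n → ℝ) : Prop :=
  ∃ ρ₁ ρ₂ : ℝ, 0 ≤ ρ₁ ∧ 0 ≤ ρ₂ ∧ ∀ x, ∀ p ∈ subdiff f x, ‖p‖ ≤ ρ₁ * ‖x‖ + ρ₂

/-- `∂f` is calm at `xh`: `∂f(x) ⊆ ∂f(xh) + L ‖x - xh‖ B₂` whenever `‖x - xh‖ ≤ c`. -/
def CalmAt {n : ℕ} (f : E n → ℝ) (xh : E n) : Prop :=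
  ∃ c L : ℝ, 0 < c ∧ 0 < L ∧ ∀ x, ‖x - xh‖ ≤ c →
    ∀ p ∈ subdiff f x, ∃ q ∈ subdiff f xh, ‖p - q‖ ≤ L * ‖x - xh‖

/-- The collection `{∂f(xh), R(Aᵀ)}` is linearly regular. -/
def LinearlyRegular {m n : ℕ} (f : E n → ℝ) (A : Matrix (Fin m) (Fin n) ℝ) (xh : E n) : Prop :=
  (subdiff f xh ∩ ran A.transpose).Nonempty ∧
    ∃ ζ : ℝ, 0 < ζ ∧ ∀ p : E n,
      Metric.infDist p (subdiff f xh ∩ ran A.transpose) ≤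
        ζ * (Metric.infDist p (subdiff f xh) + Metric.infDist p (ran A.transpose))

/-- The global error bound with constant `γ`:
`D_f^p(x, xh) ≤ (1/γ) ‖A x - y‖²` for all `x` and all `p ∈ ∂f(x) ∩ R(Aᵀ)`. -/
def ErrorBound {m n : ℕ} (f : E n → ℝ) (A : Matrix (Fin m) (Fin n) ℝ) (y : E m) (xh : E n)
    (γ : ℝ) : Prop :=
  ∀ x, ∀ p ∈ subdiff f x ∩ ran A.transpose,
    bregman f p x xh ≤ 1 / γ * ‖A.toEuclideanLin x - y‖ ^ 2

/-! ### Blocks of a matrix -/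

/-- The squared Frobenius norm. -/
def frobSq {κ ι : Type*} [Fintype κ] [Fintype ι] (B : Matrix κ ι ℝ) : ℝ :=
  ∑ i, ∑ j, B i j ^ 2

/-- The largest singular value. -/
def sigmaMax {κ ι : Type*} [Fintype κ] [Fintype ι] [DecidableEq ι] (B : Matrix κ ι ℝ) : ℝ :=
  B.toEuclideanLin.singularValues 0

/-- The row submatrix of `A` with rows indexed by `I`. -/
def rowBlock {m n : ℕ} (A : Matrix (Fin m) (Fin n) ℝ) (I : Finset (Fin m)) :
    Matrix I (Fin n) ℝ :=
  A.submatrix (fun q : I => (q : Fin m)) id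

/-- The column submatrix of `A` with columns indexed by `J`. -/
def colBlock {m n : ℕ} (A : Matrix (Fin m) (Fin n) ℝ) (J : Finset (Fin n)) :
    Matrix (Fin m) J ℝ :=
  A.submatrix id (fun l : J => (l : Fin n))

/-- The subvector of `v` with entries indexed by `I`. -/
def restrict {m : ℕ} (v : E m) (I : Finset (Fin m)) : EuclideanSpace ℝ I :=
  WithLp.toLp 2 (fun q : I => v q)

/-- `I 0, …, I (s-1)` is a partition of `[m]`. -/
def IsPartition {m s : ℕ} (I : Fin s → Finset (Fin m)) : Prop :=
  (∀ i i', i ≠ i' → Disjoint (I i) (I i')) ∧ ∀ q, ∃ i, q ∈ I i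

/-- The maximum over the row blocks of `σ_max² / ‖·‖_F²`. A zero block, which is never selected,
contributes `0`, so that it does not affect the maximum. -/
def betaRow {m n s : ℕ} (A : Matrix (Fin m) (Fin n) ℝ) (I : Fin s → Finset (Fin m)) : ℝ :=
  ⨆ i, sigmaMax (rowBlock A (I i)) ^ 2 / frobSq (rowBlock A (I i))

/-- The maximum over the column blocks of `σ_max² / ‖·‖_F²`. -/
def betaCol {m n t : ℕ} (A : Matrix (Fin m) (Fin n) ℝ) (J : Fin t → Finset (Fin n)) : ℝ :=
  ⨆ j, sigmaMax (colBlock A (J j)) ^ 2 / frobSq (colBlock A (J j))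

/-! ### The rRABEBK iteration -/

/-- The dual auxiliary iterates `z*_k`, along the selected column blocks `J (j 0), J (j 1), …`:
`z*_0 = b`, `z_k = ∇g*(z*_k)` and
`z*_{k+1} = z*_k - α / ‖A_J‖_F² · A_J A_Jᵀ z_k` with `J = J (j k)`. -/
def zStar {m n t : ℕ} (g : E m → ℝ) (A : Matrix (Fin m) (Fin n) ℝ) (b : E m)
    (J : Fin t → Finset (Fin n)) (αz : ℝ) (j : ℕ → Fin t) : ℕ → E m
  | 0 => b
  | k + 1 =>
    let B := colBlock A (J (j k))
    let zs := zStar g A b J αz j k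
    zs - (αz / frobSq B) •
      B.toEuclideanLin (B.transpose.toEuclideanLin (gradient (conj g) zs))

/-- The dual primary iterates `x*_k`, along the selected blocks: `x*_0 = 0`, `x_k = ∇f*(x*_k)` and
`x*_{k+1} = x*_k - α / ‖A_I‖_F² · A_Iᵀ (A_I x_k - b_I + z*_{k+1,I})` with `I = I (i k)`. -/
def xStar {m n s t : ℕ} (f : E n → ℝ) (g : E m → ℝ) (A : Matrix (Fin m) (Fin n) ℝ) (b : E m)
    (I : Fin s → Finset (Fin m)) (J : Fin t → Finset (Fin n)) (αx αz : ℝ)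
    (i : ℕ → Fin s) (j : ℕ → Fin t) : ℕ → E n
  | 0 => 0
  | k + 1 =>
    let B := rowBlock A (I (i k))
    let xs := xStar f g A b I J αx αz i j k
    xs - (αx / frobSq B) • B.transpose.toEuclideanLin
      (B.toEuclideanLin (gradient (conj f) xs) - restrict b (I (i k))
        + restrict (zStar g A b J αz j (k + 1)) (I (i k)))

/-- The primary iterates `x_k = ∇f*(x*_k)`. -/
def xIter {m n s t : ℕ} (f : E n → ℝ) (g : E m → ℝ) (A : Matrix (Fin m) (Fin n) ℝ) (b : E m)
    (I : Fin s → Finset (Fin m)) (J : Fin t → Finset (Fin n)) (αx αz : ℝ)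
    (i : ℕ → Fin s) (j : ℕ → Fin t) (k : ℕ) : E n :=
  gradient (conj f) (xStar f g A b I J αx αz i j k)

/-- The random selection of the blocks: the indices `j_0, i_0, j_1, i_1, …` are independent, and a
block is chosen with probability proportional to its squared Frobenius norm. -/
structure IsBlockSampling {m n s t : ℕ} {Ω : Type*} [MeasurableSpace Ω] (P : Measure Ω)
    (A : Matrix (Fin m) (Fin n) ℝ) (I : Fin s → Finset (Fin m)) (J : Fin t → Finset (Fin n))
    (i : ℕ → Ω → Fin s) (j : ℕ → Ω → Fin t) : Prop where
  measurable_row : ∀ k, Measurable (i k)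
  measurable_col : ∀ k, Measurable (j k)
  prob_row : ∀ k a, P.real {ω | i k ω = a} = frobSq (rowBlock A (I a)) / frobSq A
  prob_col : ∀ k a, P.real {ω | j k ω = a} = frobSq (colBlock A (J a)) / frobSq A
  indep_steps : iIndepFun (fun k ω => (i k ω, j k ω)) P
  indep_row_col : ∀ k, IndepFun (i k) (j k) P

/-- The Bregman distance `D_f^{x*_k}(x_k, xh)` of the `k`-th random iterate. -/
def iterDist {m n s t : ℕ} {Ω : Type*} (f : E n → ℝ) (g : E m → ℝ)
    (A : Matrix (Fin m) (Fin n) ℝ) (b : E m)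
    (I : Fin s → Finset (Fin m)) (J : Fin t → Finset (Fin n)) (αx αz : ℝ)
    (i : ℕ → Ω → Fin s) (j : ℕ → Ω → Fin t) (xh : E n) (k : ℕ) (ω : Ω) : ℝ :=
  bregman f (xStar f g A b I J αx αz (fun l => i l ω) (fun l => j l ω) k)
    (xIter f g A b I J αx αz (fun l => i l ω) (fun l => j l ω) k) xh

/-! ### The constants -/

/-- `c₁`, where `F = ‖A‖_F²`. -/
def c₁ (μ β F α ε : ℝ) : ℝ :=
  (α * (2 * μ - β * α) - 1 / ε * (α * (μ - β * α))) / (2 * μ * F)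

/-- `c₂`, where `F = ‖A‖_F²`. -/
def c₂ (μ β F α ε : ℝ) : ℝ :=
  (α ^ 2 * β + ε * (α * (μ - β * α))) / (2 * μ * F)

end

end BregmanKaczmarz

/-! Strong convexity makes `gradient (conj f)` pick, for each `p`, the point at which `p` is a
subgradient, and `conj f` has a quadratic upper bound with constant `1 / μ`. On such pairs `bregman
f p x y = f y + conj f p - ⟨p, y⟩`, so a dual step `d` changes the distance by at most a linear term
plus `‖d‖² / (2μ)` (`bregman_step_le`). For a block step, `sigmaMax B ^ 2 ≤ β * frobSq B` bounds the
quadratic term by the block residual. The sampling weights cancel the step-size denominators, so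
averaging assembles the block residuals into the full residual, which the error bound compares with
the distance itself. The error bound applies because the updates keep `x*_k` in `R(Aᵀ)` and `z*_k -
b` in `R(A)`.

The auxiliary step is exact for `Aᵀ z = 0` and contracts linearly. The primal step solves `A x = ŷ`
with the perturbation `z*_{k+1} - (b - ŷ)`. Duality gives `b - ŷ = ∇g(ẑ)`, and smoothness of `g`
bounds the squared perturbation by `2 L_g` times the auxiliary Bregman distance. Young's inequality
with parameter `ε` separates the two (`sum_dualDist_xNext_le`).

The error bound (`exists_errorBound`) starts from `D ≤ ⟨p - q, x - x̂⟩` with `q ∈ ∂f(x̂) ∩ R(Aᵀ)`.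
As `p - q = Aᵀ w` with `w` of comparable norm, `D` is at most a multiple of `‖A x - ŷ‖ ‖p - q‖`.
Regularity, calmness and growth bound the infimum of `‖p - q‖` by a multiple of `‖x - x̂‖`, and
strong convexity eliminates `‖x - x̂‖`.

Only finitely many histories precede a step, so every iterate is integrable, and independence turns
the expectation of a step into a weighted sum (`integral_step_eq`). The comparison with single rows
rests on the fact that the largest singular value of a nonzero matrix equals its Frobenius norm
exactly when the rank is one. -/

namespace BregmanKaczmarz

/-! ### Strongly convex functions and their conjugates -/

section Convex

variable {n : ℕ} {f : E n → ℝ} {μ : ℝ}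

lemma continuous_of_strongConvexOn (hμ : 0 < μ) (hf : StrongConvexOn Set.univ μ f) :
    Continuous f :=
  continuousOn_univ.1 ((hf.strictConvexOn hμ).convexOn.continuousOn isOpen_univ)

lemma strongConvexOn_sub_inner (hf : StrongConvexOn Set.univ μ f) (p : E n) :
    StrongConvexOn Set.univ μ (fun y => f y - inner ℝ p y) := by
  refine ⟨convex_univ, fun x hx y hy a b ha hb hab => ?_⟩
  have h := hf.2 hx hy ha hb hab
  simp only [smul_eq_mul, inner_add_right, inner_smul_right] at h ⊢
  linarith

/-- The subgradient inequality at `(1 - t) x + t y`, combined with strong convexity and divided by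
`t`, gives the claim as `t → 0`. -/
lemma add_half_sq_le_of_mem_subdiff (hf : StrongConvexOn Set.univ μ f) {x p : E n}
    (hp : p ∈ subdiff f x) (y : E n) :
    f x + inner ℝ p (y - x) + μ / 2 * ‖y - x‖ ^ 2 ≤ f y := by
  have key : ∀ t : ℝ, t ∈ Set.Ioo (0 : ℝ) 1 →
      f x + inner ℝ p (y - x) + (1 - t) * (μ / 2 * ‖y - x‖ ^ 2) ≤ f y := by
    intro t ht
    have h1 := hf.2 (Set.mem_univ x) (Set.mem_univ y) (sub_nonneg.2 ht.2.le) ht.1.le (by ring)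
    have h2 := hp ((1 - t) • x + t • y)
    have e : (1 - t) • x + t • y - x = t • (y - x) := by module
    rw [e, inner_smul_right] at h2
    simp only [smul_eq_mul, norm_sub_rev x y] at h1
    have h3 : t * (f x + inner ℝ p (y - x) + (1 - t) * (μ / 2 * ‖y - x‖ ^ 2)) ≤ t * f y := by
      linarith
    exact le_of_mul_le_mul_left h3 ht.1
  have lim : Tendsto (fun t : ℝ => f x + inner ℝ p (y - x) + (1 - t) * (μ / 2 * ‖y - x‖ ^ 2))
      (𝓝[>] 0) (𝓝 (f x + inner ℝ p (y - x) + (1 - 0) * (μ / 2 * ‖y - x‖ ^ 2))) :=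
    (Continuous.tendsto (by fun_prop) 0).mono_left nhdsWithin_le_nhds
  have := le_of_tendsto lim (by
    filter_upwards [Ioo_mem_nhdsGT (zero_lt_one' ℝ)] with t ht using key t ht)
  linarith

lemma half_sq_le_bregman (hf : StrongConvexOn Set.univ μ f) {x p : E n}
    (hp : p ∈ subdiff f x) (y : E n) : μ / 2 * ‖x - y‖ ^ 2 ≤ bregman f p x y := by
  have := add_half_sq_le_of_mem_subdiff hf hp y
  rw [norm_sub_rev, bregman]
  linarith

lemma bregman_nonneg {x p : E n} (hp : p ∈ subdiff f x) (y : E n) : 0 ≤ bregman f p x y := by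
  have := hp y
  rw [bregman]
  linarith

/-- A strongly convex function attains its minimum on a nonempty closed set. -/
lemma exists_isMinOn_of_strongConvexOn (hμ : 0 < μ) (hf : StrongConvexOn Set.univ μ f)
    {s : Set (E n)} (hs : IsClosed s) (hne : s.Nonempty) : ∃ x ∈ s, ∀ y ∈ s, f x ≤ f y := by
  obtain ⟨x₀, hx₀⟩ := hne
  have hc := continuous_of_strongConvexOn hμ hf
  obtain ⟨w₀, -, hw₀⟩ := (isCompact_closedBall x₀ 1).exists_isMinOn
    ⟨x₀, Metric.mem_closedBall_self zero_le_one⟩ hc.continuousOn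
  set M := f w₀
  have hM : ∀ w, ‖w - x₀‖ ≤ 1 → M ≤ f w := fun w hw =>
    hw₀ (by simpa [dist_eq_norm] using hw)
  have hM0 : M ≤ f x₀ := hM x₀ (by simp)
  refine hc.continuousOn.exists_isMinOn' hs hx₀ (Filter.Eventually.filter_mono inf_le_left ?_)
  -- Compare a far point `y` with the point at distance one from `x₀` on the segment to `y`, where
  -- `f ≥ M`. Beyond this radius the quadratic term forces `f x₀ ≤ f y`.
  filter_upwards [(isCompact_closedBall x₀ (1 + 2 * (f x₀ - M) / μ)).compl_mem_cocompact]
    with y hy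
  have hr : 1 + 2 * (f x₀ - M) / μ < ‖y - x₀‖ := by simpa [dist_eq_norm] using hy
  set r := ‖y - x₀‖ with hrdef
  have hd : 0 ≤ 2 * (f x₀ - M) / μ := by
    apply div_nonneg _ hμ.le; linarith
  have hr1 : 1 < r := by linarith
  have hr0 : 0 < r := by linarith
  have h1 := hf.2 (Set.mem_univ x₀) (Set.mem_univ y) 
    (sub_nonneg.2 (inv_le_one_of_one_le₀ hr1.le)) (show 0 ≤ r⁻¹ by positivity) (by ring)
  have h2 := hM ((1 - r⁻¹) • x₀ + r⁻¹ • y) (by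
    have e : (1 - r⁻¹) • x₀ + r⁻¹ • y - x₀ = r⁻¹ • (y - x₀) := by module
    rw [e, norm_smul, ← hrdef, Real.norm_of_nonneg (by positivity), inv_mul_cancel₀ hr0.ne'])
  simp only [smul_eq_mul, norm_sub_rev x₀ y, ← hrdef] at h1
  have h3 := mul_le_mul_of_nonneg_left (h2.trans h1) hr0.le
  have e : r * ((1 - r⁻¹) * f x₀ + r⁻¹ * f y - (1 - r⁻¹) * r⁻¹ * (μ / 2 * r ^ 2)) =
      (r - 1) * f x₀ + f y - (r - 1) * r * (μ / 2) := by
    field_simp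
  rw [e] at h3
  have h4 : 2 * (f x₀ - M) ≤ (r - 1) * μ := by
    rw [← div_le_iff₀ hμ]; linarith
  have h5 := mul_le_mul_of_nonneg_left h4 hr0.le
  linarith

/-- `f - ⟨p, ·⟩` is again strongly convex, and `p` is a subgradient of `f` at its minimiser. -/
lemma exists_mem_subdiff (hμ : 0 < μ) (hf : StrongConvexOn Set.univ μ f) (p : E n) :
    ∃ x, p ∈ subdiff f x := by
  obtain ⟨x, -, hx⟩ := exists_isMinOn_of_strongConvexOn hμ (strongConvexOn_sub_inner hf p)
    isClosed_univ Set.univ_nonempty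
  refine ⟨x, fun y => ?_⟩
  have := hx y trivial
  rw [inner_sub_right]
  linarith

lemma inner_sub_le_of_mem_subdiff {x p : E n} (hp : p ∈ subdiff f x) (y : E n) :
    inner ℝ p y - f y ≤ inner ℝ p x - f x := by
  have := hp y
  rw [inner_sub_right] at this
  linarith

lemma conj_eq_of_mem_subdiff {x p : E n} (hp : p ∈ subdiff f x) :
    conj f p = inner ℝ p x - f x :=
  le_antisymm (ciSup_le (inner_sub_le_of_mem_subdiff hp))
    (le_ciSup (f := fun y => inner ℝ p y - f y)
      ⟨_, Set.forall_mem_range.2 (inner_sub_le_of_mem_subdiff hp)⟩ x)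

lemma inner_sub_le_conj (hμ : 0 < μ) (hf : StrongConvexOn Set.univ μ f) (p y : E n) :
    inner ℝ p y - f y ≤ conj f p := by
  obtain ⟨x, hx⟩ := exists_mem_subdiff hμ hf p
  rw [conj_eq_of_mem_subdiff hx]
  exact inner_sub_le_of_mem_subdiff hx y

/-- Quadratic growth of `f` around `x` dualises: `⟨d, v⟩ - μ/2 ‖v‖²` never exceeds `‖d‖² / (2μ)`. -/
lemma conj_add_le_of_mem_subdiff (hμ : 0 < μ) (hf : StrongConvexOn Set.univ μ f) {x p : E n}
    (hp : p ∈ subdiff f x) (d : E n) :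
    conj f (p + d) ≤ conj f p + inner ℝ d x + ‖d‖ ^ 2 / (2 * μ) := by
  refine ciSup_le fun y => ?_
  rw [conj_eq_of_mem_subdiff hp]
  have h1 := add_half_sq_le_of_mem_subdiff hf hp y
  have h2 : inner ℝ d (y - x) ≤ μ / 2 * ‖y - x‖ ^ 2 + ‖d‖ ^ 2 / (2 * μ) := by
    refine (real_inner_le_norm _ _).trans ?_
    have : μ / 2 * ‖y - x‖ ^ 2 + ‖d‖ ^ 2 / (2 * μ) - ‖d‖ * ‖y - x‖ =
        (μ * ‖y - x‖ - ‖d‖) ^ 2 / (2 * μ) := by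
      field_simp; ring
    have h3 : 0 ≤ (μ * ‖y - x‖ - ‖d‖) ^ 2 / (2 * μ) := by positivity
    linarith
  rw [inner_sub_right] at h1 h2
  rw [inner_add_left]
  linarith

/-- The remainder lies between `0`, since `x` competes in the supremum at `p + d`, and `‖d‖² /
(2μ)`. -/
lemma hasGradientAt_conj (hμ : 0 < μ) (hf : StrongConvexOn Set.univ μ f) {x p : E n}
    (hp : p ∈ subdiff f x) : HasGradientAt (conj f) x p := by
  rw [hasGradientAt_iff_isLittleO_nhds_zero]
  have hO : (fun d => conj f (p + d) - conj f p - inner ℝ x d) =O[𝓝 0]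
      fun d : E n => ‖d‖ ^ 2 := by
    refine Asymptotics.IsBigO.of_bound (1 / (2 * μ)) (Filter.Eventually.of_forall fun d => ?_)
    have h1 := conj_add_le_of_mem_subdiff hμ hf hp d
    have h2 := inner_sub_le_conj hμ hf (p + d) x
    rw [conj_eq_of_mem_subdiff hp] at h1 ⊢
    rw [inner_add_left] at h2
    have e : 1 / (2 * μ) * ‖d‖ ^ 2 = ‖d‖ ^ 2 / (2 * μ) := by ring
    rw [real_inner_comm d x, Real.norm_of_nonneg (by linarith), norm_pow, norm_norm, e]
    linarith
  refine hO.trans_isLittleO ?_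
  exact Asymptotics.isLittleO_norm_pow_id one_lt_two

lemma gradient_conj_eq (hμ : 0 < μ) (hf : StrongConvexOn Set.univ μ f) {x p : E n}
    (hp : p ∈ subdiff f x) : gradient (conj f) p = x :=
  (hasGradientAt_conj hμ hf hp).gradient

lemma mem_subdiff_gradient_conj (hμ : 0 < μ) (hf : StrongConvexOn Set.univ μ f) (p : E n) :
    p ∈ subdiff f (gradient (conj f) p) := by
  obtain ⟨x, hx⟩ := exists_mem_subdiff hμ hf p
  rwa [gradient_conj_eq hμ hf hx]

/-- How the Bregman distance to a fixed point changes under a step of the dual variable. -/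
lemma bregman_step_le (hμ : 0 < μ) (hf : StrongConvexOn Set.univ μ f) (p d y : E n) :
    bregman f (p + d) (gradient (conj f) (p + d)) y ≤
      bregman f p (gradient (conj f) p) y + inner ℝ d (gradient (conj f) p - y)
        + ‖d‖ ^ 2 / (2 * μ) := by
  -- On subgradient pairs the distance is `f y + conj f p - ⟨p, y⟩`, so only `conj f` and a linear
  -- term change.
  have h := conj_add_le_of_mem_subdiff hμ hf (mem_subdiff_gradient_conj hμ hf p) d
  rw [conj_eq_of_mem_subdiff (mem_subdiff_gradient_conj hμ hf p),
    conj_eq_of_mem_subdiff (mem_subdiff_gradient_conj hμ hf (p + d))] at h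
  simp only [bregman, inner_sub_right, inner_add_left] at h ⊢
  linarith

end Convex

/-! ### Convex functions with Lipschitz gradient -/

section Smooth

variable {n : ℕ} {g : E n → ℝ}

lemma hasDerivAt_line (hgd : Differentiable ℝ g) (x d : E n) (t : ℝ) :
    HasDerivAt (fun t : ℝ => g (x + t • d)) (inner ℝ (gradient g (x + t • d)) d) t := by
  have h1 : HasDerivAt (fun t : ℝ => x + t • d) d t := by
    simpa using ((hasDerivAt_id t).smul_const d).const_add x
  have h2 := (hgd (x + t • d)).hasGradientAt.hasFDerivAt.comp_hasDerivAt t h1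
  simpa using! h2

lemma gradient_mem_subdiff (hg : ConvexOn ℝ Set.univ g) (hgd : Differentiable ℝ g) (x : E n) :
    gradient g x ∈ subdiff g x := by
  intro y
  have hd := hasDerivAt_line hgd x (y - x) 0
  rw [hasDerivAt_iff_tendsto_slope_zero] at hd
  have hd' := hd.mono_left (nhdsGT_le_nhdsNE 0)
  have := le_of_tendsto hd' (b := g y - g x) (by
    filter_upwards [Ioo_mem_nhdsGT (zero_lt_one' ℝ)] with t ht
    have h := hg.2 (Set.mem_univ x) (Set.mem_univ y) (sub_nonneg.2 ht.2.le) ht.1.le (by ring)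
    have e : (1 - t) • x + t • y = x + t • (y - x) := by module
    rw [e] at h
    simp only [zero_add, zero_smul, add_zero, smul_eq_mul] at h ⊢
    rw [inv_mul_le_iff₀ ht.1]
    linarith)
  simp only [zero_smul, add_zero] at this
  linarith

lemma eq_gradient_of_mem_subdiff (hgd : Differentiable ℝ g) {x p : E n} (hp : p ∈ subdiff g x) :
    p = gradient g x := by
  have hmin : IsLocalMin (fun y => g y - inner ℝ p y) x :=
    Filter.Eventually.of_forall fun y => by
      have := inner_sub_le_of_mem_subdiff hp y
      linarith
  have hd : HasFDerivAt (fun y => g y - inner ℝ p y)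
      (InnerProductSpace.toDual ℝ (E n) (gradient g x) - InnerProductSpace.toDual ℝ (E n) p) x :=
    (hgd x).hasGradientAt.hasFDerivAt.sub (InnerProductSpace.toDual ℝ (E n) p).hasFDerivAt
  have h0 := hmin.hasFDerivAt_eq_zero hd
  rw [sub_eq_zero] at h0
  exact ((InnerProductSpace.toDual ℝ (E n)).injective h0).symm

lemma subdiff_eq_singleton (hg : ConvexOn ℝ Set.univ g) (hgd : Differentiable ℝ g) (x : E n) :
    subdiff g x = {gradient g x} :=
  Set.Subset.antisymm (fun _ hp => eq_gradient_of_mem_subdiff hgd hp)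
    (Set.singleton_subset_iff.2 (gradient_mem_subdiff hg hgd x))

/-- The descent lemma. -/
lemma le_quadratic_of_lipschitz_gradient (hgd : Differentiable ℝ g) {L : ℝ≥0}
    (hgL : LipschitzWith L (gradient g)) (x d : E n) :
    g (x + d) ≤ g x + inner ℝ (gradient g x) d + L / 2 * ‖d‖ ^ 2 := by
  set ψ : ℝ → ℝ := fun t =>
    g (x + t • d) - (t * inner ℝ (gradient g x) d + L / 2 * ‖d‖ ^ 2 * t ^ 2) with hψ
  have hder : ∀ t, HasDerivAt ψ (inner ℝ (gradient g (x + t • d)) d -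
      (inner ℝ (gradient g x) d + L / 2 * ‖d‖ ^ 2 * (2 * t))) t := by
    intro t
    refine (hasDerivAt_line hgd x d t).sub ?_
    have h1 := (hasDerivAt_id t).mul_const (inner ℝ (gradient g x) d)
    have h2 := (hasDerivAt_pow 2 t).const_mul ((L : ℝ) / 2 * ‖d‖ ^ 2)
    simpa using! h1.add h2
  have hanti : AntitoneOn ψ (Set.Icc 0 1) := by
    refine antitoneOn_of_deriv_nonpos (convex_Icc 0 1)
      (fun t _ => (hder t).continuousAt.continuousWithinAt)
      (fun t _ => (hder t).differentiableAt.differentiableWithinAt) fun t ht => ?_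
    rw [interior_Icc] at ht
    rw [(hder t).deriv]
    have h1 : inner ℝ (gradient g (x + t • d) - gradient g x) d ≤ L * t * ‖d‖ * ‖d‖ := by
      refine (real_inner_le_norm _ _).trans (mul_le_mul_of_nonneg_right ?_ (norm_nonneg _))
      have := hgL.dist_le_mul (x + t • d) x
      rw [dist_eq_norm, dist_eq_norm, add_sub_cancel_left, norm_smul,
        Real.norm_of_nonneg ht.1.le] at this
      linarith
    rw [inner_sub_left] at h1
    nlinarith
  have h := hanti (Set.left_mem_Icc.2 zero_le_one) (Set.right_mem_Icc.2 zero_le_one) zero_le_one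
  simp only [hψ, one_smul, zero_smul, add_zero] at h
  linarith

/-- The Bregman distance controls the distance of the gradients. -/
lemma sq_norm_gradient_sub_le_bregman (hgd : Differentiable ℝ g) {L : ℝ≥0}
    (hgL : LipschitzWith L (gradient g)) {x p : E n} (hp : p ∈ subdiff g x) (y : E n) :
    ‖p - gradient g y‖ ^ 2 ≤ 2 * L * bregman g p x y := by
  obtain rfl | hL := eq_or_ne L 0
  · have h := hgL.dist_le_mul x y
    rw [eq_gradient_of_mem_subdiff hgd hp]
    simp only [NNReal.coe_zero, zero_mul, dist_le_zero] at h
    simp [h]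
  · have hL0 : (0 : ℝ) < L := by positivity
    -- This `d` maximises `⟨p - ∇g(y), d⟩ - L/2 ‖d‖²`, the gap between the subgradient bound from
    -- `x` and the descent bound from `y`, both taken at `y + d`.
    set d : E n := (1 / (L : ℝ)) • (p - gradient g y) with hd
    have h1 := le_quadratic_of_lipschitz_gradient hgd hgL y d
    have h2 := hp (y + d)
    have e : y + d - x = (y - x) + d := by abel
    rw [e, inner_add_right] at h2
    have h3 : inner ℝ p d - inner ℝ (gradient g y) d = 1 / L * ‖p - gradient g y‖ ^ 2 := by
      rw [← inner_sub_left, hd, inner_smul_right, real_inner_self_eq_norm_sq]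
    have h4 : ‖d‖ ^ 2 = (1 / L) ^ 2 * ‖p - gradient g y‖ ^ 2 := by
      rw [hd, norm_smul, mul_pow, Real.norm_of_nonneg (by positivity)]
    have h5 : 1 / L * ‖p - gradient g y‖ ^ 2 - L / 2 * ‖d‖ ^ 2 ≤ bregman g p x y := by
      rw [bregman]; linarith
    have h6 : 1 / L * ‖p - gradient g y‖ ^ 2 - L / 2 * ‖d‖ ^ 2 =
        ‖p - gradient g y‖ ^ 2 / (2 * L) := by
      rw [h4]; field_simp; ring
    rw [h6, div_le_iff₀ (by positivity)] at h5
    linarith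

end Smooth

/-! ### Singular values and the Frobenius norm -/

section Matrix

variable {κ ι : Type*} [Fintype κ] [Fintype ι] [DecidableEq ι]

lemma toEuclideanLin_transpose_eq_adjoint [DecidableEq κ] (B : Matrix κ ι ℝ) :
    B.transpose.toEuclideanLin = B.toEuclideanLin.adjoint := by
  rw [← Matrix.toEuclideanLin_conjTranspose_eq_adjoint,
    Matrix.conjTranspose_eq_transpose_of_trivial]

lemma inner_transpose_apply [DecidableEq κ] (B : Matrix κ ι ℝ) (y : EuclideanSpace ℝ κ)
    (x : EuclideanSpace ℝ ι) :
    inner ℝ (B.transpose.toEuclideanLin y) x = inner ℝ y (B.toEuclideanLin x) := by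
  rw [toEuclideanLin_transpose_eq_adjoint, LinearMap.adjoint_inner_left]

lemma toEuclideanLin_apply_eq_sum {κ : Type*} (B : Matrix κ ι ℝ) (x : EuclideanSpace ℝ ι) (q : κ) :
    B.toEuclideanLin x q = ∑ l, B q l * x l := rfl

/-- In an eigenbasis of `T* T`, `‖T x‖²` is a sum of squared coordinates weighted by eigenvalues,
each at most the largest squared singular value. -/
lemma norm_apply_le_singularValues_zero {V W : Type*} [NormedAddCommGroup V]
    [InnerProductSpace ℝ V] [FiniteDimensional ℝ V] [NormedAddCommGroup W] [InnerProductSpace ℝ W]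
    [FiniteDimensional ℝ W] (T : V →ₗ[ℝ] W) (x : V) :
    ‖T x‖ ≤ T.singularValues 0 * ‖x‖ := by
  have hT := T.isSymmetric_adjoint_comp_self
  set e := hT.eigenvectorBasis rfl
  refine le_of_sq_le_sq ?_ (mul_nonneg (T.singularValues_nonneg 0) (norm_nonneg x))
  have h1 : ‖T x‖ ^ 2 = ∑ l, e.repr x l * (hT.eigenvalues rfl l * e.repr x l) := by
    rw [← real_inner_self_eq_norm_sq, ← LinearMap.adjoint_inner_right,
      ← e.repr.inner_map_map, PiLp.inner_apply]
    refine Finset.sum_congr rfl fun l _ => ?_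
    have := hT.eigenvectorBasis_apply_self_apply rfl x l
    simp only [LinearMap.comp_apply] at this
    rw [this]
    simp [mul_comm, e]
  have h2 : ‖x‖ ^ 2 = ∑ l, e.repr x l ^ 2 := by
    rw [← e.repr.norm_map, EuclideanSpace.real_norm_sq_eq]
  rw [h1, mul_pow, h2, Finset.mul_sum]
  refine Finset.sum_le_sum fun l _ => ?_
  have h3 : hT.eigenvalues rfl l ≤ T.singularValues 0 ^ 2 := by
    rw [← T.sq_singularValues_fin rfl l]
    exact pow_le_pow_left₀ (T.singularValues_nonneg _) (T.singularValues_antitone (Nat.zero_le _)) 2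
  nlinarith [sq_nonneg (e.repr x l)]

lemma exists_norm_apply_eq_singularValues_zero {V W : Type*} [NormedAddCommGroup V]
    [InnerProductSpace ℝ V] [FiniteDimensional ℝ V] [NormedAddCommGroup W] [InnerProductSpace ℝ W]
    [FiniteDimensional ℝ W] [Nontrivial V] (T : V →ₗ[ℝ] W) :
    ∃ x : V, x ≠ 0 ∧ ‖T x‖ = T.singularValues 0 * ‖x‖ := by
  obtain ⟨x, hx⟩ := (T.hasEigenvalue_adjoint_comp_self_sq_singularValues
    (n := 0) Module.finrank_pos).exists_hasEigenvector
  refine ⟨x, hx.2, ?_⟩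
  refine (sq_eq_sq₀ (norm_nonneg _)
    (mul_nonneg (T.singularValues_nonneg 0) (norm_nonneg x))).1 ?_
  have h := hx.apply_eq_smul
  rw [LinearMap.comp_apply] at h
  rw [← real_inner_self_eq_norm_sq, ← LinearMap.adjoint_inner_right, h, inner_smul_right,
    real_inner_self_eq_norm_sq, mul_pow]
  rfl

lemma norm_apply_le_sigmaMax (B : Matrix κ ι ℝ) (x : EuclideanSpace ℝ ι) :
    ‖B.toEuclideanLin x‖ ≤ sigmaMax B * ‖x‖ :=
  norm_apply_le_singularValues_zero _ x

lemma sigmaMax_nonneg (B : Matrix κ ι ℝ) : 0 ≤ sigmaMax B :=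
  LinearMap.singularValues_nonneg _ _

/-- With `v = Bᵀ y`, Cauchy–Schwarz in `‖v‖² = ⟨y, B v⟩` leaves one factor `‖v‖` to cancel. -/
lemma norm_transpose_apply_le_sigmaMax [DecidableEq κ] (B : Matrix κ ι ℝ)
    (y : EuclideanSpace ℝ κ) : ‖B.transpose.toEuclideanLin y‖ ≤ sigmaMax B * ‖y‖ := by
  set v := B.transpose.toEuclideanLin y with hv
  have h : ‖v‖ * ‖v‖ ≤ sigmaMax B * ‖y‖ * ‖v‖ := by
    rw [← real_inner_self_eq_norm_mul_norm]
    conv_lhs => rw [hv]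
    rw [inner_transpose_apply, ← hv]
    refine (real_inner_le_norm _ _).trans ?_
    calc ‖y‖ * ‖B.toEuclideanLin v‖ ≤ ‖y‖ * (sigmaMax B * ‖v‖) := by
          gcongr; exact norm_apply_le_sigmaMax B v
      _ = _ := by ring
  rcases (norm_nonneg v).eq_or_lt with h0 | h0
  · rw [← h0]; exact mul_nonneg (sigmaMax_nonneg B) (norm_nonneg y)
  · exact le_of_mul_le_mul_right h h0

lemma frobSq_nonneg {κ ι : Type*} [Fintype κ] [Fintype ι] (B : Matrix κ ι ℝ) : 0 ≤ frobSq B :=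
  Finset.sum_nonneg fun _ _ => Finset.sum_nonneg fun _ _ => sq_nonneg _

lemma frobSq_eq_zero_iff {κ ι : Type*} [Fintype κ] [Fintype ι] (B : Matrix κ ι ℝ) :
    frobSq B = 0 ↔ B = 0 := by
  constructor
  · intro h
    ext q l
    have h1 := (Finset.sum_eq_zero_iff_of_nonneg
      fun _ _ => Finset.sum_nonneg fun _ _ => sq_nonneg _).1 h q (Finset.mem_univ q)
    have h2 := (Finset.sum_eq_zero_iff_of_nonneg fun _ _ => sq_nonneg _).1 h1 l
      (Finset.mem_univ l)
    exact pow_eq_zero_iff two_ne_zero |>.1 h2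
  · rintro rfl
    simp [frobSq]

lemma frobSq_pos {κ ι : Type*} [Fintype κ] [Fintype ι] {B : Matrix κ ι ℝ} (hB : B ≠ 0) :
    0 < frobSq B :=
  (frobSq_nonneg B).lt_of_ne' (mt (frobSq_eq_zero_iff B).1 hB)

lemma frobSq_transpose {κ ι : Type*} [Fintype κ] [Fintype ι] (B : Matrix κ ι ℝ) :
    frobSq B.transpose = frobSq B :=
  Finset.sum_comm

lemma toEuclideanLin_apply_eq_inner {κ : Type*} (B : Matrix κ ι ℝ) (x : EuclideanSpace ℝ ι) (q : κ) :
    B.toEuclideanLin x q = inner ℝ (WithLp.toLp 2 (B q)) x := by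
  rw [toEuclideanLin_apply_eq_sum, PiLp.inner_apply]
  exact Finset.sum_congr rfl fun l _ => by simp [mul_comm]

lemma frobSq_eq_sum_norm_sq {κ ι : Type*} [Fintype κ] [Fintype ι] (B : Matrix κ ι ℝ) :
    frobSq B = ∑ q, ‖(WithLp.toLp 2 (B q) : EuclideanSpace ℝ ι)‖ ^ 2 := by
  simp [frobSq, EuclideanSpace.real_norm_sq_eq]

lemma sq_row_apply_le {κ : Type*} (B : Matrix κ ι ℝ) (x : EuclideanSpace ℝ ι) (q : κ) :
    B.toEuclideanLin x q ^ 2 ≤ ‖(WithLp.toLp 2 (B q) : EuclideanSpace ℝ ι)‖ ^ 2 * ‖x‖ ^ 2 := by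
  rw [toEuclideanLin_apply_eq_inner, ← mul_pow, ← sq_abs]
  exact pow_le_pow_left₀ (abs_nonneg _) (abs_real_inner_le_norm _ _) 2

lemma sq_norm_apply_le_frobSq (B : Matrix κ ι ℝ) (x : EuclideanSpace ℝ ι) :
    ‖B.toEuclideanLin x‖ ^ 2 ≤ frobSq B * ‖x‖ ^ 2 := by
  rw [EuclideanSpace.real_norm_sq_eq, frobSq_eq_sum_norm_sq, Finset.sum_mul]
  exact Finset.sum_le_sum fun q _ => sq_row_apply_le B x q

lemma sigmaMax_of_isEmpty [IsEmpty ι] (B : Matrix κ ι ℝ) : sigmaMax B = 0 :=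
  LinearMap.singularValues_of_finrank_le _ (by simp)

lemma sigmaMax_transpose_le [DecidableEq κ] (B : Matrix κ ι ℝ) :
    sigmaMax B.transpose ≤ sigmaMax B := by
  cases isEmpty_or_nonempty κ
  · rw [sigmaMax_of_isEmpty]; exact sigmaMax_nonneg B
  obtain ⟨x, hx0, hx⟩ := exists_norm_apply_eq_singularValues_zero B.transpose.toEuclideanLin
  have h := norm_transpose_apply_le_sigmaMax B x
  rw [hx] at h
  exact le_of_mul_le_mul_right h (norm_pos_iff.2 hx0)

lemma sq_sigmaMax_le_frobSq (B : Matrix κ ι ℝ) : sigmaMax B ^ 2 ≤ frobSq B := by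
  cases isEmpty_or_nonempty ι
  · rw [sigmaMax_of_isEmpty]; simpa using frobSq_nonneg B
  obtain ⟨x, hx0, hx⟩ := exists_norm_apply_eq_singularValues_zero B.toEuclideanLin
  have h := sq_norm_apply_le_frobSq B x
  rw [hx, mul_pow] at h
  exact le_of_mul_le_mul_right h (by positivity)

/-- The largest singular value of a matrix of rank at most one is its Frobenius norm. -/
lemma frobSq_le_sq_sigmaMax_of_forall_eq_mul {B : Matrix κ ι ℝ} {u : κ → ℝ} {c : ι → ℝ}
    (hB : ∀ q l, B q l = u q * c l) : frobSq B ≤ sigmaMax B ^ 2 := by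
  set C : ℝ := ∑ l, c l ^ 2 with hC
  have hC0 : 0 ≤ C := Finset.sum_nonneg fun _ _ => sq_nonneg _
  have hF : frobSq B = (∑ q, u q ^ 2) * C := by
    simp only [frobSq, hB, mul_pow, ← Finset.mul_sum, ← Finset.sum_mul, hC]
  -- All rows are multiples of `c`, so testing with `c` gives equality in Cauchy–Schwarz in every
  -- row.
  set x : EuclideanSpace ℝ ι := WithLp.toLp 2 c with hx
  have hxn : ‖x‖ ^ 2 = C := by rw [EuclideanSpace.real_norm_sq_eq]
  have hBx : ‖B.toEuclideanLin x‖ ^ 2 = (∑ q, u q ^ 2) * C * C := by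
    rw [EuclideanSpace.real_norm_sq_eq, mul_assoc, Finset.sum_mul]
    refine Finset.sum_congr rfl fun q _ => ?_
    rw [toEuclideanLin_apply_eq_sum]
    have : ∑ l, B q l * x l = u q * C := by
      rw [hC, Finset.mul_sum]
      exact Finset.sum_congr rfl fun l _ => by rw [hB, hx]; simp only; ring
    rw [this]; ring
  have h := pow_le_pow_left₀ (norm_nonneg _) (norm_apply_le_sigmaMax B x) 2
  rw [hBx, mul_pow, hxn, ← hF] at h
  rcases hC0.eq_or_lt with h0 | h0
  · rw [hF, ← h0, mul_zero]; positivity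
  · exact le_of_mul_le_mul_right h h0

/-- At a vector attaining the largest singular value, the Cauchy–Schwarz bounds of the rows sum to
an equality. Each is then an equality, and every row is a multiple of that vector. -/
lemma forall_eq_mul_of_frobSq_le {B : Matrix κ ι ℝ} (h : frobSq B ≤ sigmaMax B ^ 2) :
    ∃ (u : κ → ℝ) (c : ι → ℝ), ∀ q l, B q l = u q * c l := by
  cases isEmpty_or_nonempty ι
  · exact ⟨0, 0, fun _ l => isEmptyElim l⟩
  obtain ⟨x, hx0, hx⟩ := exists_norm_apply_eq_singularValues_zero B.toEuclideanLin
  have h1 : frobSq B * ‖x‖ ^ 2 ≤ ‖B.toEuclideanLin x‖ ^ 2 := by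
    rw [hx, mul_pow]; exact mul_le_mul_of_nonneg_right h (sq_nonneg _)
  rw [EuclideanSpace.real_norm_sq_eq (B.toEuclideanLin x), frobSq_eq_sum_norm_sq,
    Finset.sum_mul] at h1
  have h2 := (Finset.sum_eq_sum_iff_of_le fun q _ => sq_row_apply_le B x q).1
    (le_antisymm (Finset.sum_le_sum fun q _ => sq_row_apply_le B x q) h1)
  have h3 : ∀ q, ∃ r : ℝ, (WithLp.toLp 2 (B q) : EuclideanSpace ℝ ι) = r • x := by
    intro q
    set w : EuclideanSpace ℝ ι := WithLp.toLp 2 (B q)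
    have hq := h2 q (Finset.mem_univ q)
    rw [toEuclideanLin_apply_eq_inner] at hq
    have hxx : ‖x‖ ^ 2 ≠ 0 := by positivity
    refine ⟨inner ℝ w x / ‖x‖ ^ 2, ?_⟩
    rw [← sub_eq_zero, ← norm_eq_zero, ← sq_eq_zero_iff, norm_sub_sq_real, inner_smul_right,
      norm_smul, mul_pow, Real.norm_eq_abs, sq_abs]
    field_simp
    linarith
  choose r hr using h3
  refine ⟨r, x, fun q l => ?_⟩
  have := congrArg (fun v : EuclideanSpace ℝ ι => v l) (hr q)
  simpa using this

lemma sq_sigmaMax_div_frobSq_le_one (B : Matrix κ ι ℝ) : sigmaMax B ^ 2 / frobSq B ≤ 1 :=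
  div_le_one_of_le₀ (sq_sigmaMax_le_frobSq B) (frobSq_nonneg B)

/-- The zero matrix fits too: its quotient is `0 / 0 = 0` and its rank is zero. -/
lemma sq_sigmaMax_div_frobSq_lt_one_iff (B : Matrix κ ι ℝ) :
    sigmaMax B ^ 2 / frobSq B < 1 ↔ B.rank ≠ 1 := by
  constructor
  · intro h hr
    obtain ⟨v, -, hv⟩ := finrank_eq_one_iff'.1 hr
    have hB : ∃ c : ι → ℝ, ∀ l, B.mulVecLin (Pi.single l 1) = c l • (v : κ → ℝ) := by
      have h1 : ∀ l, ∃ c : ℝ, B.mulVecLin (Pi.single l 1) = c • (v : κ → ℝ) := fun l => by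
        obtain ⟨c, hc⟩ := hv ⟨B.mulVecLin (Pi.single l 1), LinearMap.mem_range_self _ _⟩
        exact ⟨c, (congrArg Subtype.val hc).symm⟩
      choose c hc using h1
      exact ⟨c, hc⟩
    obtain ⟨c, hc⟩ := hB
    have h2 : frobSq B ≤ sigmaMax B ^ 2 := by
      refine frobSq_le_sq_sigmaMax_of_forall_eq_mul (u := v) (c := c) fun q l => ?_
      have := congrFun (hc l) q
      simpa [mul_comm] using this
    have h3 : B ≠ 0 := by rintro rfl; simp at hr
    rw [div_lt_one (frobSq_pos h3)] at h
    linarith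
  · contrapose!
    intro h
    have h0 : B ≠ 0 := by
      rintro rfl
      rw [(frobSq_eq_zero_iff _).2 rfl, div_zero] at h
      linarith
    rw [one_le_div (frobSq_pos h0)] at h
    obtain ⟨u, c, huc⟩ := forall_eq_mul_of_frobSq_le h
    have hB : B = Matrix.vecMulVec u c := by ext q l; exact huc q l
    refine le_antisymm (hB ▸ Matrix.rank_vecMulVec_le u c) (Nat.one_le_iff_ne_zero.2 fun hr => h0 ?_)
    have h1 : B.mulVecLin = 0 := LinearMap.range_eq_bot.1 (Submodule.finrank_eq_zero.1 hr)
    ext q l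
    simpa using congrFun (LinearMap.congr_fun h1 (Pi.single l 1)) q

end Matrix

/-! ### Row and column blocks -/

section Blocks

variable {m n s t : ℕ}

lemma toEuclideanLin_rowBlock_apply (A : Matrix (Fin m) (Fin n) ℝ) (I : Finset (Fin m)) (x : E n) :
    (rowBlock A I).toEuclideanLin x = restrict (A.toEuclideanLin x) I := rfl

lemma colBlock_transpose (A : Matrix (Fin m) (Fin n) ℝ) (J : Finset (Fin n)) :
    (colBlock A J).transpose = rowBlock A.transpose J := rfl

lemma sum_sum_mem_partition {I : Fin s → Finset (Fin m)} (hI : IsPartition I) (φ : Fin m → ℝ) :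
    ∑ a, ∑ q ∈ I a, φ q = ∑ q, φ q := by
  rw [← Finset.sum_biUnion fun a _ a' _ h => hI.1 a a' h]
  refine Finset.sum_congr (Finset.ext fun q => ?_) fun _ _ => rfl
  simpa using hI.2 q

lemma sum_sq_norm_restrict {I : Fin s → Finset (Fin m)} (hI : IsPartition I) (v : E m) :
    ∑ a, ‖restrict v (I a)‖ ^ 2 = ‖v‖ ^ 2 := by
  rw [EuclideanSpace.real_norm_sq_eq v, ← sum_sum_mem_partition hI]
  refine Finset.sum_congr rfl fun a _ => ?_
  rw [EuclideanSpace.real_norm_sq_eq]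
  exact Finset.sum_coe_sort (I a) fun q => v q ^ 2

lemma sum_frobSq_rowBlock (A : Matrix (Fin m) (Fin n) ℝ) {I : Fin s → Finset (Fin m)}
    (hI : IsPartition I) : ∑ a, frobSq (rowBlock A (I a)) = frobSq A := by
  rw [frobSq, ← sum_sum_mem_partition hI]
  refine Finset.sum_congr rfl fun a _ => ?_
  exact Finset.sum_coe_sort (I a) fun q => ∑ l, A q l ^ 2

lemma frobSq_colBlock (A : Matrix (Fin m) (Fin n) ℝ) (J : Finset (Fin n)) :
    frobSq (colBlock A J) = frobSq (rowBlock A.transpose J) := by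
  rw [← colBlock_transpose, frobSq_transpose]

lemma sum_frobSq_colBlock (A : Matrix (Fin m) (Fin n) ℝ) {J : Fin t → Finset (Fin n)}
    (hJ : IsPartition J) : ∑ c, frobSq (colBlock A (J c)) = frobSq A := by
  simp only [frobSq_colBlock]
  rw [sum_frobSq_rowBlock _ hJ, frobSq_transpose]

/-- In product form the bound also covers zero blocks, so later sums need no case distinction. -/
lemma sq_sigmaMax_rowBlock_le (A : Matrix (Fin m) (Fin n) ℝ) (I : Fin s → Finset (Fin m))
    (a : Fin s) :
    sigmaMax (rowBlock A (I a)) ^ 2 ≤ betaRow A I * frobSq (rowBlock A (I a)) := by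
  rcases (frobSq_nonneg (rowBlock A (I a))).eq_or_lt with h | h
  · rw [← h, mul_zero, h]; exact sq_sigmaMax_le_frobSq _
  · rw [← div_le_iff₀ h]
    exact le_ciSup (f := fun a => sigmaMax (rowBlock A (I a)) ^ 2 / frobSq (rowBlock A (I a)))
      (Set.finite_range _).bddAbove a

lemma sq_sigmaMax_colBlock_le (A : Matrix (Fin m) (Fin n) ℝ) (J : Fin t → Finset (Fin n))
    (c : Fin t) :
    sigmaMax (colBlock A (J c)) ^ 2 ≤ betaCol A J * frobSq (colBlock A (J c)) := by
  rcases (frobSq_nonneg (colBlock A (J c))).eq_or_lt with h | h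
  · rw [← h, mul_zero, h]; exact sq_sigmaMax_le_frobSq _
  · rw [← div_le_iff₀ h]
    exact le_ciSup (f := fun c => sigmaMax (colBlock A (J c)) ^ 2 / frobSq (colBlock A (J c)))
      (Set.finite_range _).bddAbove c

lemma betaRow_nonneg (A : Matrix (Fin m) (Fin n) ℝ) (I : Fin s → Finset (Fin m)) :
    0 ≤ betaRow A I :=
  Real.iSup_nonneg fun _ => div_nonneg (sq_nonneg _) (frobSq_nonneg _)

lemma betaCol_nonneg (A : Matrix (Fin m) (Fin n) ℝ) (J : Fin t → Finset (Fin n)) :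
    0 ≤ betaCol A J :=
  Real.iSup_nonneg fun _ => div_nonneg (sq_nonneg _) (frobSq_nonneg _)

lemma betaRow_pos {A : Matrix (Fin m) (Fin n) ℝ} (hA : A ≠ 0) {I : Fin s → Finset (Fin m)}
    (hI : IsPartition I) : 0 < betaRow A I := by
  refine (betaRow_nonneg A I).lt_of_ne' fun h0 => (frobSq_pos hA).ne' ?_
  rw [← sum_frobSq_rowBlock A hI]
  refine Finset.sum_eq_zero fun a _ => ?_
  have h := sq_sigmaMax_rowBlock_le A I a
  rw [h0, zero_mul] at h
  have hs : sigmaMax (rowBlock A (I a)) = 0 :=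
    pow_eq_zero_iff two_ne_zero |>.1 (le_antisymm h (sq_nonneg _))
  rw [frobSq_eq_zero_iff]
  ext q l
  have h1 := norm_apply_le_sigmaMax (rowBlock A (I a)) (EuclideanSpace.single l 1)
  rw [hs, zero_mul, norm_le_zero_iff] at h1
  have := congrArg (fun v : EuclideanSpace ℝ (I a) => v q) h1
  simpa using this

lemma betaRow_le_one (A : Matrix (Fin m) (Fin n) ℝ) (I : Fin s → Finset (Fin m)) :
    betaRow A I ≤ 1 :=
  Real.iSup_le (fun _ => sq_sigmaMax_div_frobSq_le_one _) zero_le_one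

lemma betaRow_lt_one_iff (A : Matrix (Fin m) (Fin n) ℝ) (I : Fin s → Finset (Fin m)) :
    betaRow A I < 1 ↔ ∀ a, (rowBlock A (I a)).rank ≠ 1 := by
  simp only [← sq_sigmaMax_div_frobSq_lt_one_iff]
  constructor
  · intro h a
    exact (le_ciSup (f := fun a => sigmaMax (rowBlock A (I a)) ^ 2 / frobSq (rowBlock A (I a)))
      (Set.finite_range _).bddAbove a).trans_lt h
  · intro h
    cases isEmpty_or_nonempty (Fin s)
    · rw [betaRow, Real.iSup_of_isEmpty]; exact zero_lt_one
    · obtain ⟨a, ha⟩ := exists_eq_ciSup_of_finite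
        (f := fun a => sigmaMax (rowBlock A (I a)) ^ 2 / frobSq (rowBlock A (I a)))
      rw [betaRow, ← ha]
      exact h a

/-- For single-row blocks the constant `betaRow` is one. -/
lemma betaRow_singleton {A : Matrix (Fin m) (Fin n) ℝ} (hA : A ≠ 0) :
    betaRow A (fun q : Fin m => {q}) = 1 := by
  refine le_antisymm (betaRow_le_one _ _) (not_lt.1 fun h => hA ?_)
  rw [betaRow_lt_one_iff] at h
  ext q l
  have h1 := (sq_sigmaMax_div_frobSq_lt_one_iff (rowBlock A {q})).2 (h q)
  -- A single row has quotient one unless it vanishes, so `betaRow < 1` would make every row zero.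
  have h2 : frobSq (rowBlock A {q}) ≤ sigmaMax (rowBlock A {q}) ^ 2 := by
    refine frobSq_le_sq_sigmaMax_of_forall_eq_mul (u := 1) (c := A q) fun q' l => ?_
    simp [rowBlock, Finset.mem_singleton.1 q'.2]
  have h3 : rowBlock A {q} = 0 := by
    by_contra h0
    rw [div_lt_one (frobSq_pos h0)] at h1
    linarith
  exact congrFun (congrFun h3 ⟨q, Finset.mem_singleton_self q⟩) l

end Blocks

/-! ### The range of a matrix -/

section Range

variable {m n : ℕ}

/-- In finite dimension `R(Aᵀ)` is the orthogonal complement of the kernel of `A`. -/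
lemma mem_ran_transpose_iff (A : Matrix (Fin m) (Fin n) ℝ) (v : E n) :
    v ∈ ran A.transpose ↔ ∀ x, A.toEuclideanLin x = 0 → inner ℝ v x = 0 := by
  have h : v ∈ ran A.transpose ↔ v ∈ A.toEuclideanLin.kerᗮ := by
    rw [LinearMap.orthogonal_ker, ← toEuclideanLin_transpose_eq_adjoint]
    rfl
  rw [h, Submodule.mem_orthogonal']
  rfl

lemma rowBlock_transpose_apply_mem_ran (A : Matrix (Fin m) (Fin n) ℝ) (I : Finset (Fin m))
    (w : EuclideanSpace ℝ I) : (rowBlock A I).transpose.toEuclideanLin w ∈ ran A.transpose := by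
  rw [mem_ran_transpose_iff]
  intro x hx
  rw [inner_transpose_apply, toEuclideanLin_rowBlock_apply, hx]
  have : restrict (0 : E m) I = 0 := rfl
  rw [this, inner_zero_right]

lemma colBlock_apply_mem_ran (A : Matrix (Fin m) (Fin n) ℝ) (J : Finset (Fin n))
    (w : EuclideanSpace ℝ J) : (colBlock A J).toEuclideanLin w ∈ ran A :=
  rowBlock_transpose_apply_mem_ran A.transpose J w

lemma smul_mem_ran {A : Matrix (Fin m) (Fin n) ℝ} (r : ℝ) {v : E m} (hv : v ∈ ran A) :
    r • v ∈ ran A :=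
  A.toEuclideanLin.range.smul_mem r hv

lemma zero_mem_ran (A : Matrix (Fin m) (Fin n) ℝ) : (0 : E m) ∈ ran A :=
  A.toEuclideanLin.range.zero_mem

lemma sub_mem_ran {A : Matrix (Fin m) (Fin n) ℝ} {v w : E m} (hv : v ∈ ran A) (hw : w ∈ ran A) :
    v - w ∈ ran A :=
  A.toEuclideanLin.range.sub_mem hv hw

/-- Elements of the range have preimages of proportional norm. -/
lemma exists_preimage_norm_le_of_mem_ran (A : Matrix (Fin m) (Fin n) ℝ) :
    ∃ C : ℝ, 0 < C ∧ ∀ v ∈ ran A, ∃ w, A.toEuclideanLin w = v ∧ ‖w‖ ≤ C * ‖v‖ := by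
  -- Onto its range the map is surjective, so the open mapping theorem provides `C`.
  set T : E n →L[ℝ] A.toEuclideanLin.range := A.toEuclideanLin.rangeRestrict.toContinuousLinearMap
  have hT : Function.Surjective T := A.toEuclideanLin.surjective_rangeRestrict
  obtain ⟨C, hC, h⟩ := T.exists_preimage_norm_le hT
  refine ⟨C, hC, fun v hv => ?_⟩
  obtain ⟨w, hw, hn⟩ := h ⟨v, hv⟩
  exact ⟨w, congrArg Subtype.val hw, hn⟩

end Range

/-! ### The error bound -/

section ErrorBound

variable {m n : ℕ} {A : Matrix (Fin m) (Fin n) ℝ} {f : E n → ℝ} {μ : ℝ}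

/-- The right side is the sum of the two opposite Bregman distances, and the one based at `xh` is
nonnegative. -/
lemma bregman_le_inner_sub {x xh p q : E n} (hq : q ∈ subdiff f xh) :
    bregman f p x xh ≤ inner ℝ (p - q) (x - xh) := by
  have h := hq x
  rw [bregman]
  simp only [inner_sub_left, inner_sub_right] at h ⊢
  linarith

/-- Calmness and linear growth give a global Lipschitz-type bound relative to `xh`. -/
lemma exists_infDist_subdiff_le {xh : E n} (hgrow : GrowsAtMostLinearly f) (hcalm : CalmAt f xh)
    (hne : (subdiff f xh).Nonempty) :
    ∃ K : ℝ, 0 < K ∧ ∀ x, ∀ p ∈ subdiff f x, Metric.infDist p (subdiff f xh) ≤ K * ‖x - xh‖ := by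
  obtain ⟨ρ₁, ρ₂, hρ₁, hρ₂, hρ⟩ := hgrow
  obtain ⟨c, L, hc, hL, hcL⟩ := hcalm
  obtain ⟨q, hq⟩ := hne
  set M := ρ₁ * ‖xh‖ + ρ₂ + ‖q‖ with hM
  have hM0 : 0 ≤ M := by positivity
  -- Within radius `c` calmness gives `L`. Outside it, linear growth gives `ρ₁ ‖x - xh‖ + M`, and `M
  -- ≤ (M / c) ‖x - xh‖`.
  refine ⟨L + ρ₁ + M / c, by positivity, fun x p hp => ?_⟩
  have hx := norm_nonneg (x - xh)
  rcases le_or_gt ‖x - xh‖ c with h | h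
  · obtain ⟨q', hq', hd⟩ := hcL x h p hp
    refine (Metric.infDist_le_dist_of_mem hq').trans ?_
    rw [dist_eq_norm]
    refine hd.trans (mul_le_mul_of_nonneg_right ?_ hx)
    have : 0 ≤ M / c := by positivity
    linarith
  · refine (Metric.infDist_le_dist_of_mem hq).trans ?_
    rw [dist_eq_norm]
    have h1 := norm_sub_le p q
    have h2 := hρ x p hp
    have h3 : ‖x‖ ≤ ‖x - xh‖ + ‖xh‖ := by simpa using norm_add_le (x - xh) xh
    have h4 := mul_le_mul_of_nonneg_left h3 hρ₁
    have h5 : M ≤ M / c * ‖x - xh‖ := by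
      rw [div_mul_eq_mul_div, le_div_iff₀ hc]
      exact mul_le_mul_of_nonneg_left h.le hM0
    have h6 : 0 ≤ L * ‖x - xh‖ := by positivity
    linarith

lemma exists_errorBound (hμ : 0 < μ) (hf : StrongConvexOn Set.univ μ f) {xh : E n}
    (hgrow : GrowsAtMostLinearly f) (hcalm : CalmAt f xh) (hreg : LinearlyRegular f A xh) :
    ∃ γ : ℝ, 0 < γ ∧ ErrorBound f A (A.toEuclideanLin xh) xh γ := by
  obtain ⟨hne, ζ, hζ, hreg⟩ := hreg
  obtain ⟨K, hK, hKb⟩ := exists_infDist_subdiff_le hgrow hcalm (hne.mono Set.inter_subset_left)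
  obtain ⟨C, hC, hCb⟩ := exists_preimage_norm_le_of_mem_ran A.transpose
  set S := subdiff f xh ∩ ran A.transpose with hS
  set B := C * (ζ * K) with hB
  have hB0 : 0 < B := by positivity
  -- The constant comes from `μ/2 ‖x - xh‖² ≤ D ≤ B r ‖x - xh‖`, which yields `D ≤ 2 (B r)² / μ`.
  refine ⟨μ / (2 * B ^ 2), by positivity, fun x p hp => ?_⟩
  set r := ‖A.toEuclideanLin x - A.toEuclideanLin xh‖ with hr
  have hr0 : 0 ≤ r := norm_nonneg _
  set D := bregman f p x xh with hD
  have h1 : ∀ q ∈ S, D ≤ C * r * dist p q := by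
    intro q hq
    refine (bregman_le_inner_sub hq.1).trans ?_
    obtain ⟨w, hw, hwn⟩ := hCb (p - q) (sub_mem_ran hp.2 hq.2)
    rw [← hw, inner_transpose_apply, map_sub]
    refine (real_inner_le_norm _ _).trans ?_
    rw [← hr, dist_eq_norm]
    calc ‖w‖ * r ≤ C * ‖p - q‖ * r := mul_le_mul_of_nonneg_right hwn hr0
      _ = _ := by ring
  have h2 : D ≤ C * r * Metric.infDist p S := by
    rcases hr0.eq_or_lt with h0 | h0
    · obtain ⟨q, hq⟩ := hne
      have := h1 q hq
      rw [← h0] at this ⊢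
      simpa using this
    · rw [← div_le_iff₀' (by positivity)]
      refine (Metric.le_infDist hne).2 fun q hq => ?_
      rw [div_le_iff₀' (by positivity)]
      exact h1 q hq
  have h3 : Metric.infDist p S ≤ ζ * K * ‖x - xh‖ := by
    have h := hreg p
    rw [Metric.infDist_zero_of_mem hp.2, add_zero] at h
    have := mul_le_mul_of_nonneg_left (hKb x p hp.1) hζ.le
    linarith
  have h4 : D ≤ B * r * ‖x - xh‖ := by
    refine h2.trans ((mul_le_mul_of_nonneg_left h3 (by positivity)).trans (le_of_eq ?_))
    rw [hB]; ring
  have h5 : μ / 2 * ‖x - xh‖ ^ 2 ≤ D := half_sq_le_bregman hf hp.1 xh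
  have h6 : 1 / (μ / (2 * B ^ 2)) * r ^ 2 = 2 * (B * r) ^ 2 / μ := by
    field_simp
  rw [h6, le_div_iff₀ hμ]
  have h7 : 0 ≤ D := bregman_nonneg hp.1 xh
  -- The square eliminates `‖x - xh‖` from the two bounds without dividing by it.
  nlinarith [sq_nonneg (μ * ‖x - xh‖ - 2 * (B * r)), mul_nonneg hμ.le h7]

/-- Shrinking the constant lets the contraction factors be kept in `[0, 1)`. -/
lemma ErrorBound.mono {y : E m} {xh : E n} {γ γ' : ℝ} (h : ErrorBound f A y xh γ) (hγ' : 0 < γ')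
    (hle : γ' ≤ γ) : ErrorBound f A y xh γ' := fun x p hp =>
  (h x p hp).trans (mul_le_mul_of_nonneg_right (one_div_le_one_div_of_le hγ' hle) (sq_nonneg _))

lemma ErrorBound.mul_bregman_le {y : E m} {xh : E n} {γ : ℝ} (h : ErrorBound f A y xh γ)
    (hγ : 0 < γ) {x p : E n} (hp : p ∈ subdiff f x) (hpA : p ∈ ran A.transpose) :
    γ * bregman f p x xh ≤ ‖A.toEuclideanLin x - y‖ ^ 2 := by
  have := h x p ⟨hp, hpA⟩
  rwa [one_div, ← div_eq_inv_mul, le_div_iff₀' hγ] at this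

lemma IsConstrainedMin.unique (hμ : 0 < μ) (hf : StrongConvexOn Set.univ μ f) {y : E m} {x x' : E n}
    (hx : IsConstrainedMin f A y x) (hx' : IsConstrainedMin f A y x') : x = x' := by
  by_contra hne
  have h := (hf.strictConvexOn hμ).2 (Set.mem_univ x) (Set.mem_univ x') hne
    (show (0 : ℝ) < 1 / 2 by norm_num) (show (0 : ℝ) < 1 / 2 by norm_num) (by norm_num)
  have h1 := hx.2 ((1 / 2 : ℝ) • x + (1 / 2 : ℝ) • x') (by
    rw [map_add, map_smul, map_smul, hx.1, hx'.1, ← add_smul]; norm_num)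
  have h2 := hx'.2 x hx.1
  simp only [smul_eq_mul] at h
  linarith

lemma exists_isConstrainedMin (hμ : 0 < μ) (hf : StrongConvexOn Set.univ μ f) {y : E m}
    (hy : y ∈ ran A) : ∃ x, IsConstrainedMin f A y x := by
  obtain ⟨x₀, hx₀⟩ := hy
  have hc : IsClosed {x : E n | A.toEuclideanLin x = y} :=
    isClosed_eq A.toEuclideanLin.continuous_of_finiteDimensional continuous_const
  obtain ⟨x, hx, hmin⟩ := exists_isMinOn_of_strongConvexOn hμ hf hc ⟨x₀, hx₀⟩
  exact ⟨x, hx, hmin⟩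

/-- First-order optimality for a differentiable objective. -/
lemma IsConstrainedMin.gradient_mem_ran (hfd : Differentiable ℝ f) {y : E m} {x : E n}
    (hx : IsConstrainedMin f A y x) : gradient f x ∈ ran A.transpose := by
  rw [mem_ran_transpose_iff]
  intro d hd
  have hder := hasDerivAt_line hfd x d 0
  have hmin : IsLocalMin (fun t : ℝ => f (x + t • d)) 0 :=
    Filter.Eventually.of_forall fun t => by
      simp only [zero_smul, add_zero]
      exact hx.2 _ (by rw [map_add, map_smul, hd, smul_zero, add_zero, hx.1])
  simpa using hmin.hasDerivAt_eq_zero hder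

end ErrorBound

/-! ### The dual problem -/

section Dual

variable {m n : ℕ} {A : Matrix (Fin m) (Fin n) ℝ} {g : E m → ℝ} {μ : ℝ} {b : E m}

lemma strongConvexOn_dualObj (hg : StrongConvexOn Set.univ μ g) (b : E m) :
    StrongConvexOn Set.univ μ (dualObj g b) :=
  strongConvexOn_sub_inner hg b

lemma hasGradientAt_dualObj (hgd : Differentiable ℝ g) (b z : E m) :
    HasGradientAt (dualObj g b) (gradient g z - b) z := by
  rw [hasGradientAt_iff_hasFDerivAt, map_sub]
  exact (hgd z).hasGradientAt.hasFDerivAt.sub (InnerProductSpace.toDual ℝ (E m) b).hasFDerivAt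

lemma gradient_dualObj (hgd : Differentiable ℝ g) (b : E m) :
    gradient (dualObj g b) = fun z => gradient g z - b :=
  gradient_eq (hasGradientAt_dualObj hgd b)

lemma differentiable_dualObj (hgd : Differentiable ℝ g) (b : E m) :
    Differentiable ℝ (dualObj g b) := fun z =>
  (hasGradientAt_dualObj hgd b z).differentiableAt

/-- Passing from `g` to `dualObj g b` shifts dual variables by `b`. The iteration can thus be
followed through `g`, while the error bound is stated for `dualObj g b`. -/
lemma mem_subdiff_dualObj_iff {z p : E m} : p - b ∈ subdiff (dualObj g b) z ↔ p ∈ subdiff g z := by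
  simp only [subdiff, dualObj, Set.mem_ofPred_eq]
  refine forall_congr' fun y => ?_
  simp only [inner_sub_left, inner_sub_right]
  constructor <;> intro h <;> linarith

lemma bregman_dualObj (p x y : E m) :
    bregman (dualObj g b) (p - b) x y = bregman g p x y := by
  simp only [bregman, dualObj, inner_sub_left, inner_sub_right]
  ring

lemma LipschitzWith.gradient_dualObj (hgd : Differentiable ℝ g) {L : ℝ≥0}
    (hgL : LipschitzWith L (gradient g)) (b : E m) :
    LipschitzWith L (gradient (dualObj g b)) := by
  rw [BregmanKaczmarz.gradient_dualObj hgd]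
  refine LipschitzWith.of_dist_le_mul fun x y => ?_
  simpa using hgL.dist_le_mul x y

/-! ### Smooth objectives satisfy the hypotheses of the error bound -/

section Differentiable

variable {n : ℕ} {f : E n → ℝ}

lemma growsAtMostLinearly_of_lipschitz_gradient (hfd : Differentiable ℝ f) {L : ℝ≥0}
    (hL : LipschitzWith L (gradient f)) : GrowsAtMostLinearly f := by
  refine ⟨L, ‖gradient f 0‖, L.2, norm_nonneg _, fun x p hp => ?_⟩
  rw [eq_gradient_of_mem_subdiff hfd hp]
  have h := hL.dist_le_mul x 0
  rw [dist_eq_norm, dist_zero_right] at h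
  have := norm_add_le (gradient f x - gradient f 0) (gradient f 0)
  rw [sub_add_cancel] at this
  linarith

lemma calmAt_of_lipschitz_gradient (hf : ConvexOn ℝ Set.univ f) (hfd : Differentiable ℝ f)
    {L : ℝ≥0} (hL : LipschitzWith L (gradient f)) (xh : E n) : CalmAt f xh := by
  refine ⟨1, L + 1, one_pos, by positivity, fun x _ p hp =>
    ⟨gradient f xh, gradient_mem_subdiff hf hfd xh, ?_⟩⟩
  rw [eq_gradient_of_mem_subdiff hfd hp]
  have h := hL.dist_le_mul x xh
  rw [dist_eq_norm, dist_eq_norm] at h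
  linarith [norm_nonneg (x - xh)]

lemma linearlyRegular_of_gradient_mem_ran (hf : ConvexOn ℝ Set.univ f) (hfd : Differentiable ℝ f)
    {A : Matrix (Fin m) (Fin n) ℝ} {xh : E n} (h : gradient f xh ∈ ran A.transpose) :
    LinearlyRegular f A xh := by
  rw [LinearlyRegular, subdiff_eq_singleton hf hfd, Set.singleton_inter_of_mem h]
  refine ⟨Set.singleton_nonempty _, 1, one_pos, fun p => ?_⟩
  linarith [Metric.infDist_nonneg (x := p) (s := ran A.transpose)]

end Differentiable

/-- The dual solution and its error bound. -/
lemma exists_dual_errorBound (hμ : 0 < μ) (hg : StrongConvexOn Set.univ μ g)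
    (hgd : Differentiable ℝ g) {L : ℝ≥0} (hgL : LipschitzWith L (gradient g)) {zh : E m}
    (hz : IsConstrainedMin (dualObj g b) A.transpose 0 zh) :
    ∃ θ : ℝ, 0 < θ ∧ ErrorBound (dualObj g b) A.transpose 0 zh θ := by
  have hh := strongConvexOn_dualObj hg b
  have hc := (hh.strictConvexOn hμ).convexOn
  have hd := differentiable_dualObj hgd b
  have hL := LipschitzWith.gradient_dualObj hgd hgL b
  have := exists_errorBound hμ hh (growsAtMostLinearly_of_lipschitz_gradient hd hL)
    (calmAt_of_lipschitz_gradient hc hd hL zh)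
    (linearlyRegular_of_gradient_mem_ran hc hd (hz.gradient_mem_ran hd))
  rwa [hz.1] at this

/-- The misfit problem is solved by `b - ∇g(zh)`, and only by this point. -/
lemma IsMisfitMin.eq_sub_gradient (hμ : 0 < μ) (hg : StrongConvexOn Set.univ μ g)
    (hgd : Differentiable ℝ g) {zh y : E m}
    (hz : IsConstrainedMin (dualObj g b) A.transpose 0 zh) (hy : IsMisfitMin g A b y) :
    y = b - gradient g zh := by
  have hc := (hg.strictConvexOn hμ).convexOn
  have hp₀ := gradient_mem_subdiff hc hgd zh
  have hmem : gradient g zh - b ∈ ran A := by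
    have := hz.gradient_mem_ran (differentiable_dualObj hgd b)
    rwa [gradient_dualObj hgd, Matrix.transpose_transpose] at this
  have horth : ∀ v ∈ ran A, inner ℝ v zh = 0 := by
    intro v hv
    exact (mem_ran_transpose_iff A.transpose v).1 (by rwa [Matrix.transpose_transpose]) zh hz.1
  have hmem' : b - gradient g zh ∈ ran A := by
    have := smul_mem_ran (-1) hmem
    rwa [neg_one_smul, neg_sub] at this
  have h1 := hy.2 _ hmem'
  rw [sub_sub_cancel, conj_eq_of_mem_subdiff hp₀] at h1
  have h2 := horth _ hmem'
  have h3 := horth _ hy.1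
  -- Points of `R(A)` are orthogonal to `zh`, so `⟨b - y, zh⟩ = ⟨∇g(zh), zh⟩`. Minimality of `y`
  -- then yields equality in Fenchel's inequality for `b - y` and `zh`.
  have h4 : b - y ∈ subdiff g zh := by
    intro w
    have h5 := (inner_sub_le_conj hμ hg (b - y) w).trans h1
    simp only [inner_sub_left, inner_sub_right] at h2 h5 ⊢
    linarith
  rw [← eq_gradient_of_mem_subdiff hgd h4, sub_sub_cancel]

end Dual

/-! ### One step of the iteration -/

section Step

variable {κ : Type*} [Fintype κ] [DecidableEq κ] {n : ℕ} {f : E n → ℝ} {μ : ℝ}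

/-- One Bregman-Kaczmarz step for the system `B x = B xh` with perturbed right-hand side. -/
lemma frobSq_mul_bregman_step_le (hμ : 0 < μ) (hf : StrongConvexOn Set.univ μ f)
    (B : Matrix κ (Fin n) ℝ) {β α : ℝ} (hβ0 : 0 ≤ β)
    (hβ : sigmaMax B ^ 2 ≤ β * frobSq B) (p xh : E n) (r : EuclideanSpace ℝ κ) :
    frobSq B * bregman f (p - (α / frobSq B) • B.transpose.toEuclideanLin r)
        (gradient (conj f) (p - (α / frobSq B) • B.transpose.toEuclideanLin r)) xh ≤
      frobSq B * bregman f p (gradient (conj f) p) xh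
        - α * inner ℝ r (B.toEuclideanLin (gradient (conj f) p - xh))
        + α ^ 2 * β / (2 * μ) * ‖r‖ ^ 2 := by
  set φ := frobSq B with hφ
  -- Multiplying through by `frobSq B` makes the zero block harmless: both distance terms and the
  -- inner product vanish.
  rcases (frobSq_nonneg B).eq_or_lt with h0 | h0
  · have hB : B = 0 := (frobSq_eq_zero_iff B).1 h0.symm
    have h1 : B.toEuclideanLin (gradient (conj f) p - xh) = 0 := by rw [hB]; simp
    rw [h1, inner_zero_right, hφ, ← h0]
    have : 0 ≤ α ^ 2 * β / (2 * μ) * ‖r‖ ^ 2 := by positivity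
    linarith
  · rw [← hφ] at h0
    set w := B.transpose.toEuclideanLin r with hw
    have h := bregman_step_le hμ hf p (-((α / φ) • w)) xh
    rw [← sub_eq_add_neg, inner_neg_left, inner_smul_left, hw, inner_transpose_apply, ← hw,
      norm_neg, norm_smul, mul_pow, Real.norm_eq_abs, sq_abs] at h
    have h1 : ‖w‖ ^ 2 ≤ β * φ * ‖r‖ ^ 2 := by
      refine (pow_le_pow_left₀ (norm_nonneg _) (norm_transpose_apply_le_sigmaMax B r) 2).trans ?_
      rw [mul_pow]
      exact mul_le_mul_of_nonneg_right hβ (sq_nonneg _)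
    have h2 := mul_le_mul_of_nonneg_left h h0.le
    refine h2.trans ?_
    have h3 : φ * ((α / φ) ^ 2 * ‖w‖ ^ 2 / (2 * μ)) = α ^ 2 / (2 * μ * φ) * ‖w‖ ^ 2 := by
      field_simp
    have h4 : α ^ 2 / (2 * μ * φ) * ‖w‖ ^ 2 ≤ α ^ 2 / (2 * μ * φ) * (β * φ * ‖r‖ ^ 2) :=
      mul_le_mul_of_nonneg_left h1 (by positivity)
    have h5 : α ^ 2 / (2 * μ * φ) * (β * φ * ‖r‖ ^ 2) = α ^ 2 * β / (2 * μ) * ‖r‖ ^ 2 := by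
      field_simp
    have h6 : φ * (α / φ * inner ℝ r (B.toEuclideanLin (gradient (conj f) p - xh))) =
        α * inner ℝ r (B.toEuclideanLin (gradient (conj f) p - xh)) := by
      field_simp
    simp only [conj_trivial] at h6 ⊢
    rw [mul_add, mul_add, mul_neg, h6, h3]
    linarith

/-- A Kaczmarz step for a consistent system decreases the Bregman distance. -/
lemma frobSq_mul_bregman_exact_step_le (hμ : 0 < μ) (hf : StrongConvexOn Set.univ μ f)
    (B : Matrix κ (Fin n) ℝ) {β α : ℝ} (hβ0 : 0 ≤ β)
    (hβ : sigmaMax B ^ 2 ≤ β * frobSq B) (p xh : E n) {r : EuclideanSpace ℝ κ}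
    (hr : r = B.toEuclideanLin (gradient (conj f) p - xh)) :
    frobSq B * bregman f (p - (α / frobSq B) • B.transpose.toEuclideanLin r)
        (gradient (conj f) (p - (α / frobSq B) • B.transpose.toEuclideanLin r)) xh ≤
      frobSq B * bregman f p (gradient (conj f) p) xh
        - α * (2 * μ - β * α) / (2 * μ) * ‖r‖ ^ 2 := by
  refine (frobSq_mul_bregman_step_le hμ hf B hβ0 hβ p xh r).trans (le_of_eq ?_)
  rw [← hr, real_inner_self_eq_norm_sq]
  field_simp
  ring

/-- A Kaczmarz step for a perturbed system, with the perturbation split off by Young's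
inequality. -/
lemma frobSq_mul_bregman_perturbed_step_le (hμ : 0 < μ) (hf : StrongConvexOn Set.univ μ f)
    (B : Matrix κ (Fin n) ℝ) {β α ε : ℝ} (hβ0 : 0 ≤ β)
    (hβ : sigmaMax B ^ 2 ≤ β * frobSq B) (hα : 0 ≤ α) (hαβ : β * α ≤ μ) (hε : 0 < ε)
    (p xh : E n) {r u v : EuclideanSpace ℝ κ}
    (hu : u = B.toEuclideanLin (gradient (conj f) p - xh)) (hr : r = u + v) :
    frobSq B * bregman f (p - (α / frobSq B) • B.transpose.toEuclideanLin r)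
        (gradient (conj f) (p - (α / frobSq B) • B.transpose.toEuclideanLin r)) xh ≤
      frobSq B * bregman f p (gradient (conj f) p) xh
        - (α * (2 * μ - β * α) - 1 / ε * (α * (μ - β * α))) / (2 * μ) * ‖u‖ ^ 2
        + (α ^ 2 * β + ε * (α * (μ - β * α))) / (2 * μ) * ‖v‖ ^ 2 := by
  refine (frobSq_mul_bregman_step_le hμ hf B hβ0 hβ p xh r).trans ?_
  rw [← hu, hr, inner_add_left, real_inner_self_eq_norm_sq, norm_add_sq_real,
    real_inner_comm u v]
  have hY : 0 ≤ 1 / ε * ‖u‖ ^ 2 + 2 * inner ℝ u v + ε * ‖v‖ ^ 2 := by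
    have h1 := (abs_le.1 (abs_real_inner_le_norm u v)).1
    have h2 : 1 / ε * ‖u‖ ^ 2 - 2 * (‖u‖ * ‖v‖) + ε * ‖v‖ ^ 2 =
        1 / ε * (‖u‖ - ε * ‖v‖) ^ 2 := by
      field_simp; ring
    have h3 : 0 ≤ 1 / ε * (‖u‖ - ε * ‖v‖) ^ 2 := by positivity
    linarith
  -- Twice this is the coefficient of `-⟨u, v⟩` after expanding `r = u + v`. It is nonnegative
  -- because `β * α ≤ μ`.
  have hc : 0 ≤ α * (μ - β * α) / (2 * μ) :=
    div_nonneg (mul_nonneg hα (by linarith)) (by linarith)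
  have h := mul_nonneg hc hY
  rw [← sub_nonneg]
  refine h.trans (le_of_eq ?_)
  field_simp
  ring

end Step

/-! ### Conditional expectation of one step, with the error bound -/

section Iteration

variable {m n s t : ℕ} {A : Matrix (Fin m) (Fin n) ℝ} {b : E m} {f : E n → ℝ} {g : E m → ℝ}
  {μ μf μg : ℝ}

/-- One dual step with the column block `c`. -/
noncomputable def zNext (g : E m → ℝ) (A : Matrix (Fin m) (Fin n) ℝ) (J : Fin t → Finset (Fin n))
    (αz : ℝ) (zs : E m) (c : Fin t) : E m :=
  zs - (αz / frobSq (colBlock A (J c))) • (colBlock A (J c)).toEuclideanLin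
    ((colBlock A (J c)).transpose.toEuclideanLin (gradient (conj g) zs))

/-- One primal step with the row block `a`. -/
noncomputable def xNext (f : E n → ℝ) (A : Matrix (Fin m) (Fin n) ℝ) (b : E m)
    (I : Fin s → Finset (Fin m)) (αx : ℝ) (xs : E n) (zs : E m) (a : Fin s) : E n :=
  xs - (αx / frobSq (rowBlock A (I a))) • (rowBlock A (I a)).transpose.toEuclideanLin
    ((rowBlock A (I a)).toEuclideanLin (gradient (conj f) xs) - restrict b (I a)
      + restrict zs (I a))

lemma zNext_sub_mem_ran (J : Fin t → Finset (Fin n)) (αz : ℝ) {zs : E m} (h : zs - b ∈ ran A)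
    (c : Fin t) : zNext g A J αz zs c - b ∈ ran A := by
  have := sub_mem_ran h (smul_mem_ran (αz / frobSq (colBlock A (J c)))
    (colBlock_apply_mem_ran A (J c)
      ((colBlock A (J c)).transpose.toEuclideanLin (gradient (conj g) zs))))
  rwa [sub_right_comm] at this

lemma xNext_mem_ran (I : Fin s → Finset (Fin m)) (αx : ℝ) {xs : E n}
    (h : xs ∈ ran A.transpose) (zs : E m) (a : Fin s) :
    xNext f A b I αx xs zs a ∈ ran A.transpose :=
  sub_mem_ran h (smul_mem_ran _ (rowBlock_transpose_apply_mem_ran A (I a) _))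

/-- The Bregman distance of the dual variable `p` to `xh`. -/
noncomputable def dualDist (f : E n → ℝ) (xh p : E n) : ℝ :=
  bregman f p (gradient (conj f) p) xh

lemma dualDist_nonneg (hμ : 0 < μ) (hf : StrongConvexOn Set.univ μ f) (xh p : E n) :
    0 ≤ dualDist f xh p :=
  bregman_nonneg (mem_subdiff_gradient_conj hμ hf p) xh

/-- The expected decrease in a dual step. -/
lemma sum_dualDist_zNext_le (hA : A ≠ 0) (hμ : 0 < μg) (hg : StrongConvexOn Set.univ μg g)
    {J : Fin t → Finset (Fin n)} (hJ : IsPartition J) {αz θ : ℝ} (hα : 0 < αz)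
    (hαβ : betaCol A J * αz ≤ 2 * μg) {zh : E m} (hzh : A.transpose.toEuclideanLin zh = 0)
    (hθ : 0 < θ) (hE : ErrorBound (dualObj g b) A.transpose 0 zh θ) {zs : E m}
    (hzs : zs - b ∈ ran A) :
    ∑ c, frobSq (colBlock A (J c)) / frobSq A * dualDist g zh (zNext g A J αz zs c) ≤
      (1 - αz * (2 * μg - betaCol A J * αz) * θ / (2 * μg * frobSq A)) * dualDist g zh zs := by
  have hF := frobSq_pos hA
  set z := gradient (conj g) zs with hz
  set η := αz * (2 * μg - betaCol A J * αz) / (2 * μg) with hη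
  have hη0 : 0 ≤ η := div_nonneg (mul_nonneg hα.le (by linarith)) (by linarith)
  have h1 : ∀ c, frobSq (colBlock A (J c)) * dualDist g zh (zNext g A J αz zs c) ≤
      frobSq (colBlock A (J c)) * dualDist g zh zs
        - η * ‖restrict (A.transpose.toEuclideanLin z) (J c)‖ ^ 2 := by
    intro c
    -- A transposed column block is a row block of `Aᵀ`, so this is an exact Kaczmarz step for `Aᵀ z
    -- = 0`.
    have hr : (rowBlock A.transpose (J c)).toEuclideanLin z =
        (rowBlock A.transpose (J c)).toEuclideanLin (z - zh) := by
      rw [map_sub, toEuclideanLin_rowBlock_apply _ _ zh, hzh]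
      exact (sub_zero _).symm
    have hσ : sigmaMax (rowBlock A.transpose (J c)) ^ 2 ≤
        betaCol A J * frobSq (rowBlock A.transpose (J c)) := by
      rw [← frobSq_colBlock]
      exact (pow_le_pow_left₀ (sigmaMax_nonneg _) (sigmaMax_transpose_le (colBlock A (J c))) 2).trans
        (sq_sigmaMax_colBlock_le A J c)
    have := frobSq_mul_bregman_exact_step_le (α := αz) hμ hg (rowBlock A.transpose (J c))
      (betaCol_nonneg A J) hσ zs zh hr
    rw [← frobSq_colBlock] at this
    exact this
  have h2 : ∑ c, frobSq (colBlock A (J c)) * dualDist g zh (zNext g A J αz zs c) ≤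
      frobSq A * dualDist g zh zs - η * ‖A.transpose.toEuclideanLin z‖ ^ 2 := by
    refine (Finset.sum_le_sum fun c _ => h1 c).trans (le_of_eq ?_)
    rw [Finset.sum_sub_distrib, ← Finset.sum_mul, sum_frobSq_colBlock A hJ, ← Finset.mul_sum,
      sum_sq_norm_restrict hJ]
  have h3 : θ * dualDist g zh zs ≤ ‖A.transpose.toEuclideanLin z‖ ^ 2 := by
    have := hE.mul_bregman_le hθ
      (mem_subdiff_dualObj_iff.2 (mem_subdiff_gradient_conj hμ hg zs))
      (by rwa [Matrix.transpose_transpose])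
    rwa [bregman_dualObj, sub_zero] at this
  have h4 := mul_le_mul_of_nonneg_left h3 hη0
  have h5 : ∑ c, frobSq (colBlock A (J c)) / frobSq A * dualDist g zh (zNext g A J αz zs c) =
      (∑ c, frobSq (colBlock A (J c)) * dualDist g zh (zNext g A J αz zs c)) / frobSq A := by
    rw [Finset.sum_div]
    exact Finset.sum_congr rfl fun c _ => by ring
  have h6 : (1 - αz * (2 * μg - betaCol A J * αz) * θ / (2 * μg * frobSq A)) * dualDist g zh zs =
      (frobSq A * dualDist g zh zs - η * (θ * dualDist g zh zs)) / frobSq A := by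
    rw [hη]; field_simp
  rw [h5, h6]
  gcongr
  linarith

/-- The expected change in a primal step. -/
lemma sum_dualDist_xNext_le (hA : A ≠ 0) (hμ : 0 < μf) (hf : StrongConvexOn Set.univ μf f)
    {I : Fin s → Finset (Fin m)} (hI : IsPartition I) {αx ε γ : ℝ} (hα : 0 < αx)
    (hαβ : betaRow A I * αx ≤ μf) (hε : 0 < ε) (hc : 0 ≤ c₁ μf (betaRow A I) (frobSq A) αx ε)
    {yh : E m} {xh : E n} (hxh : A.toEuclideanLin xh = yh)
    (hγ : 0 < γ) (hE : ErrorBound f A yh xh γ) {xs : E n} (hxs : xs ∈ ran A.transpose) (zs : E m) :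
    ∑ a, frobSq (rowBlock A (I a)) / frobSq A * dualDist f xh (xNext f A b I αx xs zs a) ≤
      (1 - c₁ μf (betaRow A I) (frobSq A) αx ε * γ) * dualDist f xh xs
        + c₂ μf (betaRow A I) (frobSq A) αx ε * ‖zs - (b - yh)‖ ^ 2 := by
  have hF := frobSq_pos hA
  set x := gradient (conj f) xs with hx
  set β := betaRow A I with hβ
  set K₁ := (αx * (2 * μf - β * αx) - 1 / ε * (αx * (μf - β * αx))) / (2 * μf) with hK₁
  set K₂ := (αx ^ 2 * β + ε * (αx * (μf - β * αx))) / (2 * μf) with hK₂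
  have hc₁ : c₁ μf β (frobSq A) αx ε = K₁ / frobSq A := by rw [c₁, hK₁, div_div]
  have hc₂ : c₂ μf β (frobSq A) αx ε = K₂ / frobSq A := by rw [c₂, hK₂, div_div]
  have h1 : ∀ a, frobSq (rowBlock A (I a)) * dualDist f xh (xNext f A b I αx xs zs a) ≤
      frobSq (rowBlock A (I a)) * dualDist f xh xs
        - K₁ * ‖restrict (A.toEuclideanLin x - yh) (I a)‖ ^ 2
        + K₂ * ‖restrict (zs - (b - yh)) (I a)‖ ^ 2 := by
    intro a
    refine frobSq_mul_bregman_perturbed_step_le hμ hf (rowBlock A (I a)) (betaRow_nonneg A I)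
      (sq_sigmaMax_rowBlock_le A I a) hα.le hαβ hε xs xh ?_ ?_
    · rw [toEuclideanLin_rowBlock_apply, map_sub, hxh]
    -- The residual splits as `(A x - yh) + (zs - (b - yh))`, restricted to the block.
    · ext q
      simp [restrict, toEuclideanLin_rowBlock_apply]
      ring
  have h2 : ∑ a, frobSq (rowBlock A (I a)) * dualDist f xh (xNext f A b I αx xs zs a) ≤
      frobSq A * dualDist f xh xs - K₁ * ‖A.toEuclideanLin x - yh‖ ^ 2
        + K₂ * ‖zs - (b - yh)‖ ^ 2 := by
    refine (Finset.sum_le_sum fun a _ => h1 a).trans (le_of_eq ?_)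
    rw [Finset.sum_add_distrib, Finset.sum_sub_distrib, ← Finset.sum_mul, sum_frobSq_rowBlock A hI,
      ← Finset.mul_sum, ← Finset.mul_sum, sum_sq_norm_restrict hI, sum_sq_norm_restrict hI]
  have h3 : γ * dualDist f xh xs ≤ ‖A.toEuclideanLin x - yh‖ ^ 2 :=
    hE.mul_bregman_le hγ (mem_subdiff_gradient_conj hμ hf xs) hxs
  -- The error bound only bounds the residual from below, so its coefficient must be nonnegative.
  have hK0 : 0 ≤ K₁ := by
    rw [hc₁] at hc
    have := mul_nonneg hc hF.le
    rwa [div_mul_cancel₀ _ hF.ne'] at this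
  have h4 := mul_le_mul_of_nonneg_left h3 hK0
  have h5 : ∑ a, frobSq (rowBlock A (I a)) / frobSq A * dualDist f xh (xNext f A b I αx xs zs a) =
      (∑ a, frobSq (rowBlock A (I a)) * dualDist f xh (xNext f A b I αx xs zs a)) / frobSq A := by
    rw [Finset.sum_div]
    exact Finset.sum_congr rfl fun c _ => by ring
  have h6 : (1 - K₁ / frobSq A * γ) * dualDist f xh xs + K₂ / frobSq A * ‖zs - (b - yh)‖ ^ 2 =
      (frobSq A * dualDist f xh xs - K₁ * (γ * dualDist f xh xs)
        + K₂ * ‖zs - (b - yh)‖ ^ 2) / frobSq A := by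
    field_simp
  rw [hc₁, hc₂, h5, h6]
  gcongr
  linarith

end Iteration

/-! ### Expectations along the random selection -/

section Sampling

variable {m n s t : ℕ} {Ω : Type*} [MeasurableSpace Ω] {P : Measure Ω}
  {A : Matrix (Fin m) (Fin n) ℝ} {I : Fin s → Finset (Fin m)} {J : Fin t → Finset (Fin n)}
  {i : ℕ → Ω → Fin s} {j : ℕ → Ω → Fin t}

/-- The blocks drawn in the first `k` steps. -/
def history (i : ℕ → Ω → Fin s) (j : ℕ → Ω → Fin t) (k : ℕ) (ω : Ω) :
    Finset.range k → Fin s × Fin t :=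
  fun l => (i l ω, j l ω)

lemma measurable_history (h : IsBlockSampling P A I J i j) (k : ℕ) :
    Measurable (history i j k) :=
  measurable_pi_lambda _ fun l => (h.measurable_row l).prodMk (h.measurable_col l)

lemma indepFun_history (h : IsBlockSampling P A I J i j) (k : ℕ) :
    IndepFun (history i j k) (fun ω => (i k ω, j k ω)) P := by
  have h1 := h.indep_steps.indepFun_finset (Finset.range k) {k} (by simp)
    fun l => (h.measurable_row l).prodMk (h.measurable_col l)
  exact h1.comp measurable_id
    (measurable_pi_apply (⟨k, Finset.mem_singleton_self k⟩ : ({k} : Finset ℕ)))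

lemma measureReal_step (h : IsBlockSampling P A I J i j) (k : ℕ) (a : Fin s) (c : Fin t) :
    (P.map fun ω => (i k ω, j k ω)).real {(a, c)} =
      frobSq (rowBlock A (I a)) / frobSq A * (frobSq (colBlock A (J c)) / frobSq A) := by
  rw [map_measureReal_apply ((h.measurable_row k).prodMk (h.measurable_col k))
    (measurableSet_singleton _), ← h.prob_row k a, ← h.prob_col k c]
  have h1 := (h.indep_row_col k).measure_inter_preimage_eq_mul {a} {c}
    (measurableSet_singleton a) (measurableSet_singleton c)
  have h2 : (fun ω => (i k ω, j k ω)) ⁻¹' {(a, c)} = i k ⁻¹' {a} ∩ j k ⁻¹' {c} := by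
    ext ω; simp
  rw [h2, measureReal_def, h1, ENNReal.toReal_mul]
  rfl

variable [IsProbabilityMeasure P] {W : Type*} {S : Ω → W} {k : ℕ}

/-- Functions of the history are integrable. -/
lemma integrable_of_factorsThrough_history (h : IsBlockSampling P A I J i j)
    {V : Type*} [NormedAddCommGroup V] {S : Ω → V}
    (hS : S.FactorsThrough (history i j k)) : Integrable S P := by
  obtain ⟨e, rfl⟩ := (Function.factorsThrough_iff S).1 hS
  have : Integrable e (P.map (history i j k)) := by
    have := Measure.isProbabilityMeasure_map (μ := P) (measurable_history h k).aemeasurable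
    exact .of_finite
  exact this.comp_measurable (measurable_history h k)

/-- Averaging over the blocks drawn in step `k`, which are independent of the history. -/
lemma integral_step_eq [Nonempty W] (h : IsBlockSampling P A I J i j)
    (hS : S.FactorsThrough (history i j k)) (ψ : W → Fin s → Fin t → ℝ) :
    ∫ ω, ψ (S ω) (i k ω) (j k ω) ∂P = ∫ ω, ∑ c, frobSq (colBlock A (J c)) / frobSq A *
      ∑ a, frobSq (rowBlock A (I a)) / frobSq A * ψ (S ω) a c ∂P := by
  obtain ⟨e, rfl⟩ := (Function.factorsThrough_iff S).1 hS
  have hX := measurable_history h k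
  have hY : Measurable fun ω => (i k ω, j k ω) := (h.measurable_row k).prodMk (h.measurable_col k)
  have := Measure.isProbabilityMeasure_map (μ := P) hX.aemeasurable
  have := Measure.isProbabilityMeasure_map (μ := P) hY.aemeasurable
  set F : (Finset.range k → Fin s × Fin t) × (Fin s × Fin t) → ℝ :=
    fun q => ψ (e q.1) q.2.1 q.2.2 with hF
  have h1 : ∫ ω, ψ (e (history i j k ω)) (i k ω) (j k ω) ∂P =
      ∫ q, F q ∂(P.map fun ω => (history i j k ω, (i k ω, j k ω))) :=
    (integral_map (hX.prodMk hY).aemeasurable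
      (Measurable.of_discrete (f := F)).aestronglyMeasurable).symm
  have h2 : ∀ x, ∫ y, F (x, y) ∂(P.map fun ω => (i k ω, j k ω)) =
      ∑ c, frobSq (colBlock A (J c)) / frobSq A *
        ∑ a, frobSq (rowBlock A (I a)) / frobSq A * ψ (e x) a c := by
    intro x
    rw [integral_fintype .of_finite, Fintype.sum_prod_type_right]
    refine Finset.sum_congr rfl fun c _ => ?_
    rw [Finset.mul_sum]
    refine Finset.sum_congr rfl fun a _ => ?_
    rw [measureReal_step h, smul_eq_mul]
    ring
  simp only [Function.comp_apply]
  -- Independence makes the joint law a product, and Fubini integrates out the current draw.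
  rw [h1, (indepFun_history h k).map_prod_eq_prod_map_map hX.aemeasurable hY.aemeasurable,
    integral_prod _ .of_finite]
  simp only [h2]
  rw [integral_map hX.aemeasurable (Measurable.of_discrete).aestronglyMeasurable]

end Sampling

/-! ### Expected estimates along the iteration -/

section States

variable {m n s t : ℕ} {A : Matrix (Fin m) (Fin n) ℝ} {b : E m} {f : E n → ℝ} {g : E m → ℝ}
  {I : Fin s → Finset (Fin m)} {J : Fin t → Finset (Fin n)} {αx αz : ℝ}

lemma zStar_congr {j j' : ℕ → Fin t} {k : ℕ} (h : ∀ l < k, j l = j' l) :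
    zStar g A b J αz j k = zStar g A b J αz j' k := by
  induction k with
  | zero => rfl
  | succ k ih =>
    change zNext g A J αz _ (j k) = zNext g A J αz _ (j' k)
    rw [ih fun l hl => h l (hl.trans k.lt_succ_self), h k k.lt_succ_self]

lemma xStar_congr {i i' : ℕ → Fin s} {j j' : ℕ → Fin t} {k : ℕ} (hi : ∀ l < k, i l = i' l)
    (hj : ∀ l < k, j l = j' l) :
    xStar f g A b I J αx αz i j k = xStar f g A b I J αx αz i' j' k := by
  induction k with
  | zero => rfl
  | succ k ih =>
    change xNext f A b I αx _ (zStar g A b J αz j (k + 1)) (i k) =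
      xNext f A b I αx _ (zStar g A b J αz j' (k + 1)) (i' k)
    rw [zStar_congr hj, hi k k.lt_succ_self,
      ih (fun l hl => hi l (hl.trans k.lt_succ_self)) fun l hl => hj l (hl.trans k.lt_succ_self)]

lemma zStar_sub_mem_ran (j : ℕ → Fin t) (k : ℕ) : zStar g A b J αz j k - b ∈ ran A := by
  induction k with
  | zero => simpa [zStar] using zero_mem_ran A
  | succ k ih => exact zNext_sub_mem_ran J αz ih (j k)

lemma xStar_mem_ran (i : ℕ → Fin s) (j : ℕ → Fin t) (k : ℕ) :
    xStar f g A b I J αx αz i j k ∈ ran A.transpose := by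
  induction k with
  | zero => exact zero_mem_ran _
  | succ k ih => exact xNext_mem_ran I αx ih _ (i k)

/-- The pair of dual iterates. -/
noncomputable def state {Ω : Type*} (f : E n → ℝ) (g : E m → ℝ) (A : Matrix (Fin m) (Fin n) ℝ)
    (b : E m) (I : Fin s → Finset (Fin m)) (J : Fin t → Finset (Fin n)) (αx αz : ℝ)
    (i : ℕ → Ω → Fin s) (j : ℕ → Ω → Fin t) (k : ℕ) (ω : Ω) : E n × E m :=
  (xStar f g A b I J αx αz (fun l => i l ω) (fun l => j l ω) k,
    zStar g A b J αz (fun l => j l ω) k)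

lemma state_factorsThrough {Ω : Type*} (i : ℕ → Ω → Fin s) (j : ℕ → Ω → Fin t) (k : ℕ) :
    (state f g A b I J αx αz i j k).FactorsThrough (history i j k) := by
  intro ω ω' h
  have h1 : ∀ l < k, (i l ω, j l ω) = (i l ω', j l ω') := fun l hl =>
    congrFun h (⟨l, Finset.mem_range.2 hl⟩ : Finset.range k)
  have hi : ∀ l < k, i l ω = i l ω' := fun l hl => congrArg Prod.fst (h1 l hl)
  have hj : ∀ l < k, j l ω = j l ω' := fun l hl => congrArg Prod.snd (h1 l hl)
  exact Prod.ext (xStar_congr hi hj) (zStar_congr hj)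

variable {Ω : Type*} [MeasurableSpace Ω] {P : Measure Ω} [IsProbabilityMeasure P]
  {i : ℕ → Ω → Fin s} {j : ℕ → Ω → Fin t}

lemma integrable_comp_state {V : Type*} [NormedAddCommGroup V] (h : IsBlockSampling P A I J i j)
    (k : ℕ) (φ : E n × E m → V) :
    Integrable (fun ω => φ (state f g A b I J αx αz i j k ω)) P :=
  integrable_of_factorsThrough_history h fun _ _ hh => congrArg φ (state_factorsThrough i j k hh)

variable {μf μg : ℝ} {zh : E m} {θ : ℝ}

lemma sum_prob_row (hA : A ≠ 0) (hI : IsPartition I) :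
    ∑ a, frobSq (rowBlock A (I a)) / frobSq A = 1 := by
  rw [← Finset.sum_div, sum_frobSq_rowBlock A hI, div_self (frobSq_pos hA).ne']

lemma sum_prob_col (hA : A ≠ 0) (hJ : IsPartition J) :
    ∑ c, frobSq (colBlock A (J c)) / frobSq A = 1 := by
  rw [← Finset.sum_div, sum_frobSq_colBlock A hJ, div_self (frobSq_pos hA).ne']

lemma integral_dualDist_zStar_succ_eq (hA : A ≠ 0) (hI : IsPartition I)
    (h : IsBlockSampling P A I J i j) (k : ℕ) :
    ∫ ω, dualDist g zh (zStar g A b J αz (fun l => j l ω) (k + 1)) ∂P =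
      ∫ ω, ∑ c, frobSq (colBlock A (J c)) / frobSq A *
        dualDist g zh (zNext g A J αz (zStar g A b J αz (fun l => j l ω) k) c) ∂P := by
  -- The auxiliary iterates do not involve `f` or `αx`, so zero placeholders complete the state. The
  -- row probabilities then sum to one.
  have h1 := integral_step_eq h (state_factorsThrough (f := fun _ : E n => 0) (g := g) (A := A)
    (b := b) (I := I) (J := J) (αx := 0) (αz := αz) i j k)
    fun S _ c => dualDist g zh (zNext g A J αz S.2 c)
  simp only [← Finset.sum_mul, sum_prob_row hA hI, one_mul] at h1
  exact h1

/-- Expected linear convergence of the auxiliary iterates. -/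
lemma integral_dualDist_zStar_le (hA : A ≠ 0) (hμ : 0 < μg) (hg : StrongConvexOn Set.univ μg g)
    (hI : IsPartition I) (hJ : IsPartition J) (h : IsBlockSampling P A I J i j) (hα : 0 < αz)
    (hαβ : betaCol A J * αz ≤ 2 * μg) (hzh : A.transpose.toEuclideanLin zh = 0)
    (hθ : 0 < θ) (hE : ErrorBound (dualObj g b) A.transpose 0 zh θ) (k : ℕ) :
    ∫ ω, dualDist g zh (zStar g A b J αz (fun l => j l ω) k) ∂P ≤
      (1 - αz * (2 * μg - betaCol A J * αz) * θ / (2 * μg * frobSq A)) ^ k * dualDist g zh b := by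
  set q := 1 - αz * (2 * μg - betaCol A J * αz) * θ / (2 * μg * frobSq A) with hq
  set d : ℕ → ℝ := fun k => ∫ ω, dualDist g zh (zStar g A b J αz (fun l => j l ω) k) ∂P with hd
  have hd0 : ∀ k, 0 ≤ d k := fun k => integral_nonneg fun ω => dualDist_nonneg hμ hg zh _
  have hd1 : d 0 = dualDist g zh b := by simp [hd, zStar]
  have hint := fun k (φ : E n × E m → ℝ) =>
    integrable_comp_state (f := fun _ => 0) (g := g) (b := b) (αx := 0) (αz := αz) h k φ
  have hstep : ∀ k, d (k + 1) ≤ q * d k := by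
    intro k
    rw [hd]
    simp only
    rw [integral_dualDist_zStar_succ_eq hA hI h, ← integral_const_mul]
    refine integral_mono (hint k fun S => ∑ c, frobSq (colBlock A (J c)) / frobSq A *
      dualDist g zh (zNext g A J αz S.2 c)) (hint k fun S => q * dualDist g zh S.2) fun ω => ?_
    exact sum_dualDist_zNext_le hA hμ hg hJ hα hαβ hzh hθ hE (zStar_sub_mem_ran _ _)
  change d k ≤ q ^ k * dualDist g zh b
  rw [← hd1]
  rcases le_or_gt 0 q with h0 | h0
  · induction k with
    | zero => simp
    | succ k ih =>
      refine (hstep k).trans ((mul_le_mul_of_nonneg_left ih h0).trans (le_of_eq ?_))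
      ring
  -- A negative factor together with nonnegative distances forces all of them to be zero.
  · have hz : ∀ k, d k = 0 := fun k =>
      le_antisymm (by nlinarith [hstep k, hd0 (k + 1), hd0 k]) (hd0 k)
    rw [hz, hz, mul_zero]

/-- The recursive estimate for the expected Bregman distance. -/
lemma integral_iterDist_succ_le (hA : A ≠ 0) (hμf : 0 < μf) (hf : StrongConvexOn Set.univ μf f)
    (hμg : 0 < μg) (hg : StrongConvexOn Set.univ μg g)
    (hgd : Differentiable ℝ g) {Lg : ℝ≥0} (hgL : LipschitzWith Lg (gradient g))
    (hI : IsPartition I) (hJ : IsPartition J) (h : IsBlockSampling P A I J i j)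
    {yh : E m} {xh : E n} (hxh : A.toEuclideanLin xh = yh)
    (hzh : A.transpose.toEuclideanLin zh = 0) (hyh : yh = b - gradient g zh)
    {ε γ : ℝ} (hαx : 0 < αx) (hαβx : betaRow A I * αx ≤ μf) (hαz : 0 < αz)
    (hαβz : betaCol A J * αz ≤ 2 * μg) (hε : 0 < ε)
    (hc : 0 ≤ c₁ μf (betaRow A I) (frobSq A) αx ε)
    (hγ : 0 < γ) (hEx : ErrorBound f A yh xh γ)
    (hθ : 0 < θ) (hEz : ErrorBound (dualObj g b) A.transpose 0 zh θ) (k : ℕ) :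
    ∫ ω, iterDist f g A b I J αx αz i j xh (k + 1) ω ∂P ≤
      (1 - c₁ μf (betaRow A I) (frobSq A) αx ε * γ) *
          ∫ ω, iterDist f g A b I J αx αz i j xh k ω ∂P
        + c₂ μf (betaRow A I) (frobSq A) αx ε * (2 * Lg *
          (1 - αz * (2 * μg - betaCol A J * αz) * θ / (2 * μg * frobSq A)) ^ (k + 1) *
          dualDist g zh b) := by
  set C₁ := c₁ μf (betaRow A I) (frobSq A) αx ε
  set C₂ := c₂ μf (betaRow A I) (frobSq A) αx ε with hC₂
  have hβ := betaRow_nonneg A I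
  have hF := frobSq_pos hA
  have hC₂0 : 0 ≤ C₂ :=
    div_nonneg (add_nonneg (by positivity)
      (mul_nonneg hε.le (mul_nonneg hαx.le (by linarith)))) (by positivity)
  have hint := fun k (φ : E n × E m → ℝ) =>
    integrable_comp_state (f := f) (g := g) (b := b) (αx := αx) (αz := αz) h k φ
  have h1 : ∫ ω, iterDist f g A b I J αx αz i j xh (k + 1) ω ∂P =
      ∫ ω, ∑ c, frobSq (colBlock A (J c)) / frobSq A *
        ∑ a, frobSq (rowBlock A (I a)) / frobSq A * dualDist f xh
          (xNext f A b I αx (state f g A b I J αx αz i j k ω).1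
            (zNext g A J αz (state f g A b I J αx αz i j k ω).2 c) a) ∂P :=
    integral_step_eq h (state_factorsThrough i j k) fun S a c =>
      dualDist f xh (xNext f A b I αx S.1 (zNext g A J αz S.2 c) a)
  have h2 : ∀ ω, ∑ c, frobSq (colBlock A (J c)) / frobSq A *
        ∑ a, frobSq (rowBlock A (I a)) / frobSq A * dualDist f xh
          (xNext f A b I αx (state f g A b I J αx αz i j k ω).1
            (zNext g A J αz (state f g A b I J αx αz i j k ω).2 c) a) ≤
      (1 - C₁ * γ) * dualDist f xh (state f g A b I J αx αz i j k ω).1 +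
        C₂ * (2 * Lg) * ∑ c, frobSq (colBlock A (J c)) / frobSq A *
          dualDist g zh (zNext g A J αz (state f g A b I J αx αz i j k ω).2 c) := by
    intro ω
    set S := state f g A b I J αx αz i j k ω
    have hS : S.1 ∈ ran A.transpose := xStar_mem_ran _ _ _
    have h3 : ∀ c, frobSq (colBlock A (J c)) / frobSq A *
        ∑ a, frobSq (rowBlock A (I a)) / frobSq A * dualDist f xh
          (xNext f A b I αx S.1 (zNext g A J αz S.2 c) a) ≤
        frobSq (colBlock A (J c)) / frobSq A * ((1 - C₁ * γ) * dualDist f xh S.1) +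
          C₂ * (2 * Lg) * (frobSq (colBlock A (J c)) / frobSq A *
            dualDist g zh (zNext g A J αz S.2 c)) := by
      intro c
      have hp : 0 ≤ frobSq (colBlock A (J c)) / frobSq A := div_nonneg (frobSq_nonneg _) hF.le
      have h4 := sum_dualDist_xNext_le hA hμf hf hI hαx hαβx hε hc hxh hγ hEx hS (b := b)
        (zNext g A J αz S.2 c)
      have h5 : ‖zNext g A J αz S.2 c - (b - yh)‖ ^ 2 ≤
          2 * Lg * dualDist g zh (zNext g A J αz S.2 c) := by
        -- Since `b - yh = ∇g(zh)`, the perturbation is a difference of gradients. The primal step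
        -- uses the new auxiliary iterate, whence the power `k + 1`.
        rw [hyh, sub_sub_cancel]
        exact sq_norm_gradient_sub_le_bregman hgd hgL (mem_subdiff_gradient_conj hμg hg _) zh
      have h6 := mul_le_mul_of_nonneg_left h5 hC₂0
      have h7 := mul_le_mul_of_nonneg_left (h4.trans (add_le_add_right h6 _)) hp
      refine h7.trans (le_of_eq ?_)
      ring
    refine (Finset.sum_le_sum fun c _ => h3 c).trans (le_of_eq ?_)
    rw [Finset.sum_add_distrib, ← Finset.sum_mul, sum_prob_col hA hJ, one_mul, ← Finset.mul_sum]
  have h8 := integral_mono (hint k fun S => ∑ c, frobSq (colBlock A (J c)) / frobSq A *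
      ∑ a, frobSq (rowBlock A (I a)) / frobSq A * dualDist f xh
        (xNext f A b I αx S.1 (zNext g A J αz S.2 c) a))
    (hint k fun S => (1 - C₁ * γ) * dualDist f xh S.1 +
        C₂ * (2 * Lg) * ∑ c, frobSq (colBlock A (J c)) / frobSq A *
          dualDist g zh (zNext g A J αz S.2 c)) h2
  rw [h1]
  refine h8.trans ?_
  rw [integral_add (hint k fun S => (1 - C₁ * γ) * dualDist f xh S.1)
    (hint k fun S => C₂ * (2 * Lg) * ∑ c, frobSq (colBlock A (J c)) / frobSq A *
          dualDist g zh (zNext g A J αz S.2 c)), integral_const_mul, integral_const_mul]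
  have h9 := integral_dualDist_zStar_le hA hμg hg hI hJ h hαz hαβz hzh hθ hEz (k + 1)
  rw [integral_dualDist_zStar_succ_eq hA hI h] at h9
  have h10 := mul_le_mul_of_nonneg_left h9
    (show 0 ≤ C₂ * (2 * Lg) from mul_nonneg hC₂0 (by positivity))
  refine (add_le_add_right h10 _).trans (le_of_eq ?_)
  rw [mul_assoc C₂, ← mul_assoc (2 * (Lg : ℝ))]
  rfl

end States

/-! ### Convergence -/

section Convergence

/-- With `r = max ρ q`, induction gives `a k ≤ a 0 * r ^ k + C * k * r ^ k`. The factor `k` also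
covers `ρ = q`. -/
lemma tendsto_zero_of_le_mul_add_pow {a : ℕ → ℝ} {ρ q C : ℝ} (ha : ∀ k, 0 ≤ a k)
    (hρ0 : 0 ≤ ρ) (hρ1 : ρ < 1) (hq0 : 0 ≤ q) (hq1 : q < 1) (hC : 0 ≤ C)
    (h : ∀ k, a (k + 1) ≤ ρ * a k + C * q ^ (k + 1)) : Tendsto a atTop (𝓝 0) := by
  set r := max ρ q with hr
  have hr0 : 0 ≤ r := hρ0.trans (le_max_left _ _)
  have hr1 : r < 1 := max_lt hρ1 hq1
  have hb : ∀ k : ℕ, a k ≤ a 0 * r ^ k + C * (k * r ^ k) := by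
    intro k
    induction k with
    | zero => simp
    | succ k ih =>
      have h1 : ρ * a k ≤ r * (a 0 * r ^ k + C * (k * r ^ k)) :=
        mul_le_mul (le_max_left _ _) ih (ha k) hr0
      have h2 : C * q ^ (k + 1) ≤ C * r ^ (k + 1) :=
        mul_le_mul_of_nonneg_left (pow_le_pow_left₀ hq0 (le_max_right _ _) _) hC
      refine (h k).trans ((add_le_add h1 h2).trans (le_of_eq ?_))
      push_cast
      ring
  refine squeeze_zero ha hb ?_
  have h1 := (tendsto_pow_atTop_nhds_zero_of_lt_one hr0 hr1).const_mul (a 0)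
  have h2 := (tendsto_self_mul_const_pow_of_lt_one hr0 hr1).const_mul C
  simpa using h1.add h2

/-- Jensen's inequality, from the nonnegative expectation of `(‖X - x‖ - c)²` with `c` the mean of
`‖X - x‖`. -/
lemma sq_norm_integral_sub_le {Ω : Type*} [MeasurableSpace Ω] {P : Measure Ω}
    [IsProbabilityMeasure P] {V : Type*} [NormedAddCommGroup V] [NormedSpace ℝ V] [CompleteSpace V]
    {X : Ω → V} (x : V) (hX : Integrable X P) (hX2 : Integrable (fun ω => ‖X ω - x‖ ^ 2) P) :
    ‖∫ ω, X ω ∂P - x‖ ^ 2 ≤ ∫ ω, ‖X ω - x‖ ^ 2 ∂P := by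
  have hY : Integrable (fun ω => ‖X ω - x‖) P := (hX.sub (integrable_const x)).norm
  have h1 : ‖∫ ω, X ω ∂P - x‖ ≤ ∫ ω, ‖X ω - x‖ ∂P := by
    have : ∫ ω, X ω ∂P - x = ∫ ω, (X ω - x) ∂P := by
      rw [integral_sub hX (integrable_const x)]; simp
    rw [this]
    exact norm_integral_le_integral_norm _
  set c := ∫ ω, ‖X ω - x‖ ∂P with hc
  have h2 : 0 ≤ ∫ ω, (‖X ω - x‖ ^ 2 - (2 * c * ‖X ω - x‖ - c ^ 2)) ∂P :=
    integral_nonneg fun ω => by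
      have := sq_nonneg (‖X ω - x‖ - c)
      simp only [Pi.zero_apply]
      linarith
  have hZ : Integrable (fun ω => 2 * c * ‖X ω - x‖ - c ^ 2) P :=
    (hY.const_mul _).sub (integrable_const _)
  rw [integral_sub hX2 hZ,
    integral_sub (hY.const_mul _) (integrable_const _), integral_const_mul, ← hc] at h2
  simp only [integral_const, probReal_univ, one_smul] at h2
  have h3 := pow_le_pow_left₀ (norm_nonneg _) h1 2
  linarith

/-- At `ε = 1` the constant is positive for every admissible step size, which suits the convergence
proof. -/
lemma c₁_one {μ : ℝ} (hμ : 0 < μ) (β F α : ℝ) : c₁ μ β F α 1 = α / (2 * F) := by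
  rw [c₁]
  field_simp
  ring

lemma mul_le_of_le_div' {α μ β : ℝ} (hα : 0 < α) (hβ : 0 ≤ β) (h : α ≤ μ / β) : β * α ≤ μ := by
  rcases hβ.eq_or_lt with h0 | h0
  · rw [← h0, div_zero] at h; linarith
  · rwa [le_div_iff₀' h0] at h

lemma mul_lt_of_lt_div' {α μ β : ℝ} (hα : 0 < α) (hβ : 0 ≤ β) (h : α < μ / β) : β * α < μ := by
  rcases hβ.eq_or_lt with h0 | h0
  · rw [← h0, div_zero] at h; linarith
  · rwa [lt_div_iff₀' h0] at h

variable {m n s t : ℕ} {A : Matrix (Fin m) (Fin n) ℝ} {b : E m} {f : E n → ℝ} {g : E m → ℝ}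
  {I : Fin s → Finset (Fin m)} {J : Fin t → Finset (Fin n)} {αx αz : ℝ}
  {Ω : Type*} [MeasurableSpace Ω] {P : Measure Ω} [IsProbabilityMeasure P]
  {i : ℕ → Ω → Fin s} {j : ℕ → Ω → Fin t} {μf μg : ℝ} {zh : E m} {xh : E n} {yh : E m}

lemma tendsto_integral_iterDist (hA : A ≠ 0) (hμf : 0 < μf)
    (hf : StrongConvexOn Set.univ μf f)
    (hμg : 0 < μg) (hg : StrongConvexOn Set.univ μg g)
    (hgd : Differentiable ℝ g) {Lg : ℝ≥0} (hgL : LipschitzWith Lg (gradient g))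
    (hI : IsPartition I) (hJ : IsPartition J) (h : IsBlockSampling P A I J i j)
    (hxh : A.toEuclideanLin xh = yh)
    (hzh : A.transpose.toEuclideanLin zh = 0) (hyh : yh = b - gradient g zh)
    (hαx : 0 < αx) (hαβx : betaRow A I * αx ≤ μf) (hαz : 0 < αz)
    (hαβz : betaCol A J * αz < 2 * μg)
    {γ θ : ℝ} (hγ : 0 < γ) (hEx : ErrorBound f A yh xh γ)
    (hθ : 0 < θ) (hEz : ErrorBound (dualObj g b) A.transpose 0 zh θ) :
    Tendsto (fun k => ∫ ω, iterDist f g A b I J αx αz i j xh k ω ∂P) atTop (𝓝 0) := by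
  have hF := frobSq_pos hA
  set C₁ := c₁ μf (betaRow A I) (frobSq A) αx 1 with hC₁
  have hC₁0 : 0 < C₁ := by rw [hC₁, c₁_one hμf]; positivity
  set η := αz * (2 * μg - betaCol A J * αz) / (2 * μg * frobSq A) with hη
  have hη0 : 0 < η := div_pos (mul_pos hαz (by linarith)) (by positivity)
  -- The error bounds persist for smaller constants. These minima keep both factors in `[0, 1)`.
  have hγ' : 0 < min γ (1 / C₁) := lt_min hγ (by positivity)
  have hθ' : 0 < min θ (1 / η) := lt_min hθ (by positivity)
  have hγ1 : C₁ * min γ (1 / C₁) ≤ 1 := by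
    rw [← le_div_iff₀' hC₁0]; exact min_le_right _ _
  have hθ1 : η * min θ (1 / η) ≤ 1 := by
    rw [← le_div_iff₀' hη0]; exact min_le_right _ _
  have hrec := integral_iterDist_succ_le hA hμf hf hμg hg hgd hgL hI hJ h hxh hzh hyh hαx hαβx hαz
    hαβz.le one_pos hC₁0.le hγ' (hEx.mono hγ' (min_le_left _ _)) hθ'
    (hEz.mono hθ' (min_le_left _ _))
  have hβ := betaRow_nonneg A I
  have hC₂0 : 0 ≤ c₂ μf (betaRow A I) (frobSq A) αx 1 :=
    div_nonneg (add_nonneg (by positivity)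
      (mul_nonneg zero_le_one (mul_nonneg hαx.le (by linarith)))) (by positivity)
  refine tendsto_zero_of_le_mul_add_pow (ρ := 1 - C₁ * min γ (1 / C₁))
    (q := 1 - η * min θ (1 / η))
    (C := c₂ μf (betaRow A I) (frobSq A) αx 1 * (2 * Lg * dualDist g zh b))
    (fun k => integral_nonneg fun ω => dualDist_nonneg hμf hf xh _)
    (by linarith) (by linarith [mul_pos hC₁0 hγ']) (by linarith) (by linarith [mul_pos hη0 hθ'])
    (mul_nonneg hC₂0 (mul_nonneg (by positivity) (dualDist_nonneg hμg hg zh b))) fun k => ?_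
  refine (hrec k).trans (le_of_eq ?_)
  rw [hη, div_mul_eq_mul_div]
  ring

/-- The factor `c₁` is largest at the largest admissible relaxation parameter. -/
lemma c₁_lt {μ β F α ε : ℝ} (hμ : 0 < μ) (hβ : 0 < β) (hF : 0 < F) (hα : 0 < α) (hαβ : β * α < μ)
    (hε : 0 < ε) : c₁ μ β F α ε < μ / (2 * β * F) := by
  have h1 : 0 ≤ 1 / ε * (α * (μ - β * α)) :=
    mul_nonneg (by positivity) (mul_nonneg hα.le (by linarith))
  have h2 : 0 < (μ - β * α) ^ 2 := pow_pos (by linarith) 2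
  rw [c₁, div_lt_div_iff₀ (by positivity) (by positivity)]
  -- The gap is `(μ - β * α) ^ 2`.
  have h3 : (α * (2 * μ - β * α)) * β < μ ^ 2 := by linarith
  have h4 : (α * (2 * μ - β * α) - 1 / ε * (α * (μ - β * α))) * β < μ ^ 2 :=
    lt_of_le_of_lt (mul_le_mul_of_nonneg_right (by linarith) hβ.le) h3
  have h5 := mul_lt_mul_of_pos_right h4 (show 0 < 2 * F by positivity)
  linarith

lemma c₁_div_self {μ β F ε : ℝ} (hμ : 0 < μ) (hβ : 0 < β) :
    c₁ μ β F (μ / β) ε = μ / (2 * β * F) := by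
  rw [c₁, mul_div_cancel₀ _ hβ.ne', sub_self, mul_zero, mul_zero, sub_zero]
  field_simp
  ring

end Convergence

end BregmanKaczmarz

/-! ### Assembly of the theorem -/

open BregmanKaczmarz in
theorem mainTheorem2 {m n s t : ℕ}
    (A : Matrix (Fin m) (Fin n) ℝ) (hA : A ≠ 0) (b : E m)
    (f : E n → ℝ) (μf : ℝ) (hμf : 0 < μf) (hf : StrongConvexOn Set.univ μf f)
    (g : E m → ℝ) (μg : ℝ) (hμg : 0 < μg) (hg : StrongConvexOn Set.univ μg g)
    (hgd : Differentiable ℝ g) (Lg : ℝ≥0) (hgL : LipschitzWith Lg (gradient g))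
    (yhat : E m) (hyhat : IsMisfitMin g A b yhat)
    (xhat : E n) (hxhat : IsConstrainedMin f A yhat xhat)
    (hgrow : GrowsAtMostLinearly f) (hcalm : CalmAt f xhat) (hreg : LinearlyRegular f A xhat)
    (I : Fin s → Finset (Fin m)) (hI : IsPartition I)
    (J : Fin t → Finset (Fin n)) (hJ : IsPartition J)
    {Ω : Type*} [MeasurableSpace Ω] (P : Measure Ω) [IsProbabilityMeasure P]
    (i : ℕ → Ω → Fin s) (j : ℕ → Ω → Fin t) (hij : IsBlockSampling P A I J i j) :
    -- uniqueness of the solutions of the misfit problem and of the constrained problem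
    (∀ y, IsMisfitMin g A b y → y = yhat) ∧
    (∀ x, IsConstrainedMin f A yhat x → x = xhat) ∧
    -- the unique solution of the dual problem
    (∃ zhat, IsConstrainedMin (dualObj g b) A.transpose 0 zhat ∧
      (∀ z, IsConstrainedMin (dualObj g b) A.transpose 0 z → z = zhat) ∧
      -- the constants of the global error bounds exist
      (∃ γ : ℝ, 0 < γ ∧ ErrorBound f A yhat xhat γ) ∧
      (∃ θ : ℝ, 0 < θ ∧ ErrorBound (dualObj g b) A.transpose 0 zhat θ) ∧
      -- the recursive estimate
      (∀ αx αz ε γ θ : ℝ,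
        0 < αx → αx ≤ μf / betaRow A I → 0 < αz → αz < 2 * μg / betaCol A J →
        0 < ε → 0 ≤ c₁ μf (betaRow A I) (frobSq A) αx ε →
        0 < γ → ErrorBound f A yhat xhat γ →
        0 < θ → ErrorBound (dualObj g b) A.transpose 0 zhat θ →
        ∀ k : ℕ,
          ∫ ω, iterDist f g A b I J αx αz i j xhat (k + 1) ω ∂P ≤
            (1 - c₁ μf (betaRow A I) (frobSq A) αx ε * γ) *
                ∫ ω, iterDist f g A b I J αx αz i j xhat k ω ∂P
              + c₂ μf (betaRow A I) (frobSq A) αx ε * (2 * Lg *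
                (1 - αz * (2 * μg - betaCol A J * αz) * θ / (2 * μg * frobSq A)) ^ (k + 1) *
                bregman (dualObj g b) 0 (gradient (conj g) b) zhat))) ∧
    -- convergence in expectation
    (∀ αx αz : ℝ,
      0 < αx → αx ≤ μf / betaRow A I → 0 < αz → αz < 2 * μg / betaCol A J →
      (∀ k, Integrable (iterDist f g A b I J αx αz i j xhat k) P) ∧
      (∀ k, Integrable
        (fun ω => xIter f g A b I J αx αz (fun l => i l ω) (fun l => j l ω) k) P) ∧
      (∀ k, Integrable
        (fun ω => ‖xIter f g A b I J αx αz (fun l => i l ω) (fun l => j l ω) k - xhat‖ ^ 2) P) ∧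
      Tendsto (fun k => ∫ ω, iterDist f g A b I J αx αz i j xhat k ω ∂P) atTop (𝓝 0) ∧
      Tendsto (fun k => ∫ ω,
        ‖xIter f g A b I J αx αz (fun l => i l ω) (fun l => j l ω) k - xhat‖ ^ 2 ∂P)
        atTop (𝓝 0) ∧
      Tendsto (fun k => ∫ ω,
        xIter f g A b I J αx αz (fun l => i l ω) (fun l => j l ω) k ∂P) atTop (𝓝 xhat)) ∧
    -- the optimal relaxation parameter and its contraction factor
    (∀ ε γ : ℝ, 0 < ε → 0 < γ →
      1 - c₁ μf (betaRow A I) (frobSq A) (μf / betaRow A I) ε * γ =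
        1 - μf * γ / (2 * betaRow A I * frobSq A) ∧
      ∀ αx : ℝ, 0 < αx → αx < μf / betaRow A I →
        1 - μf * γ / (2 * betaRow A I * frobSq A) <
          1 - c₁ μf (betaRow A I) (frobSq A) αx ε * γ) ∧
    -- comparison with the factor of REBK, the case of single-row blocks
    betaRow A (fun q : Fin m => {q}) = 1 ∧
    (∀ γ : ℝ, 0 < γ →
      1 - μf * γ / (2 * betaRow A I * frobSq A) ≤ 1 - μf * γ / (2 * frobSq A) ∧
      (1 - μf * γ / (2 * betaRow A I * frobSq A) < 1 - μf * γ / (2 * frobSq A) ↔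
        ∀ a, (rowBlock A (I a)).rank ≠ 1)) := by
  obtain ⟨zhat, hz⟩ :=
    exists_isConstrainedMin hμg (strongConvexOn_dualObj hg b) (zero_mem_ran A.transpose)
  have hy : yhat = b - gradient g zhat := hyhat.eq_sub_gradient hμg hg hgd hz
  have hF := frobSq_pos hA
  have hβ := betaRow_pos hA hI
  obtain ⟨γ₀, hγ₀, hE₀⟩ := exists_errorBound hμf hf hgrow hcalm hreg
  rw [hxhat.1] at hE₀
  obtain ⟨θ₀, hθ₀, hEz₀⟩ := exists_dual_errorBound hμg hg hgd hgL hz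
  -- The start `z*_0 = b` corresponds to the dual variable `0` of `dualObj g b`.
  have hgb : bregman (dualObj g b) 0 (gradient (conj g) b) zhat = dualDist g zhat b := by
    have h := bregman_dualObj (g := g) (b := b) b (gradient (conj g) b) zhat
    rwa [sub_self] at h
  refine ⟨fun y h => (h.eq_sub_gradient hμg hg hgd hz).trans hy.symm,
    fun x h => h.unique hμf hf hxhat,
    ⟨zhat, hz, fun z h => h.unique hμg (strongConvexOn_dualObj hg b) hz, ⟨γ₀, hγ₀, hE₀⟩,
      ⟨θ₀, hθ₀, hEz₀⟩, ?_⟩, ?_, ?_, betaRow_singleton hA, ?_⟩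
  · intro αx αz ε γ θ hαx hαx' hαz hαz' hε hc hγ hEx hθ hEz k
    rw [hgb]
    exact integral_iterDist_succ_le hA hμf hf hμg hg hgd hgL hI hJ hij hxhat.1 hz.1 hy hαx
      (mul_le_of_le_div' hαx hβ.le hαx') hαz
      (mul_lt_of_lt_div' hαz (betaCol_nonneg A J) hαz').le hε hc hγ hEx hθ hEz k
  · intro αx αz hαx hαx' hαz hαz'
    have hint : ∀ k, Integrable (iterDist f g A b I J αx αz i j xhat k) P := fun k =>
      integrable_comp_state hij k fun S => dualDist f xhat S.1
    have hintx : ∀ k, Integrable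
        (fun ω => xIter f g A b I J αx αz (fun l => i l ω) (fun l => j l ω) k) P := fun k =>
      integrable_comp_state (g := g) (b := b) (αx := αx) (αz := αz) hij k
        fun S => gradient (conj f) S.1
    have hintx2 : ∀ k, Integrable
        (fun ω => ‖xIter f g A b I J αx αz (fun l => i l ω) (fun l => j l ω) k - xhat‖ ^ 2) P :=
      fun k => integrable_comp_state (g := g) (b := b) (αx := αx) (αz := αz) hij k
        fun S => ‖gradient (conj f) S.1 - xhat‖ ^ 2
    have hlim := tendsto_integral_iterDist hA hμf hf hμg hg hgd hgL hI hJ hij hxhat.1 hz.1 hy hαx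
      (mul_le_of_le_div' hαx hβ.le hαx') hαz
      (mul_lt_of_lt_div' hαz (betaCol_nonneg A J) hαz') hγ₀ hE₀ hθ₀ hEz₀
    have hlim2 : Tendsto (fun k => ∫ ω,
        ‖xIter f g A b I J αx αz (fun l => i l ω) (fun l => j l ω) k - xhat‖ ^ 2 ∂P)
        atTop (𝓝 0) := by
      refine squeeze_zero (fun k => integral_nonneg fun ω => sq_nonneg _) (fun k => ?_)
        (by simpa using hlim.const_mul (2 / μf))
      rw [← integral_const_mul]
      -- Strong convexity bounds the squared distance by `2 / μf` times the Bregman distance.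
      refine integral_mono (hintx2 k) ((hint k).const_mul _) fun ω => ?_
      have h := half_sq_le_bregman hf (mem_subdiff_gradient_conj hμf hf
        (xStar f g A b I J αx αz (fun l => i l ω) (fun l => j l ω) k)) xhat
      have h' := mul_le_mul_of_nonneg_left h (show 0 ≤ 2 / μf by positivity)
      refine le_trans (le_of_eq ?_) h'
      rw [xIter]
      field_simp
    refine ⟨hint, hintx, hintx2, hlim, hlim2, ?_⟩
    rw [tendsto_iff_norm_sub_tendsto_zero]
    have h := squeeze_zero (fun k => sq_nonneg _)
      (fun k => sq_norm_integral_sub_le xhat (hintx k) (hintx2 k)) hlim2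
    simpa using h.sqrt
  · intro ε γ hε hγ
    have h0 : μf * γ / (2 * betaRow A I * frobSq A) = μf / (2 * betaRow A I * frobSq A) * γ :=
      mul_div_right_comm _ _ _
    rw [c₁_div_self hμf hβ, h0]
    refine ⟨rfl, fun αx hαx hαx' => ?_⟩
    have := mul_lt_mul_of_pos_right
      (c₁_lt hμf hβ hF hαx (mul_lt_of_lt_div' hαx hβ.le hαx') hε) hγ
    linarith
  · intro γ hγ
    have h0 : μf * γ / (2 * betaRow A I * frobSq A) = μf * γ / (2 * frobSq A) / betaRow A I := by
      field_simp
    have h1 : 0 < μf * γ / (2 * frobSq A) := by positivity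
    rw [h0, ← betaRow_lt_one_iff, sub_le_sub_iff_left, sub_lt_sub_iff_left, le_div_iff₀ hβ,
      lt_div_iff₀ hβ, mul_lt_iff_lt_one_right h1]
    exact ⟨mul_le_of_le_one_right h1.le (betaRow_le_one A I), Iff.rfl⟩
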